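/- Let $q \in \mathbb{C}[X]$ be a nonzero polynomial, let $\varphi(t) = e^{-ct^2}$ with $c > 0$, let $I = [a,b] \subseteq \mathbb{R}$ with $a < b$ be a nondegenerate compact interval, and let $\Lambda \subseteq \mathbb{R}$ be a (finite or infinite) sequence of distinct real numbers, that is, a countable set. Let $X$ be one of the complex Banach spaces $C(I)$ (with the supremum norm) or $L^p(I)$ (with respect to Lebesgue measure) with $1 \le p < \infty$. Then the following two statements are equivalent. 1. The system of translates $\{ (q\varphi)(\cdot - \lambda) : \lambda \in \Lambda \}$, restricted to $I$, is complete in $X$, i.e. its complex linear span is dense in $X$. 2. $\displaystyle \sum_{\lambda \in \Lambda,\ \lambda \neq 0} \frac{1}{|\lambda|} = \infty$. -/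

import Mathlib

open MeasureTheory Polynomial
open scoped ENNReal

/-- The system of translates `{f(· - l) : l ∈ Λ}` of a function `f : ℝ → ℂ`. -/
def translates (f : ℝ → ℂ) (Λ : Set ℝ) : Set (ℝ → ℂ) :=
  {u | ∃ l ∈ Λ, u = fun t => f (t - l)}

/-- The product `q φ` of a complex polynomial `q` with the Gaussian `φ(t) = exp (-c t ^ 2)`. -/
noncomputable def polyGaussian (q : ℂ[X]) (c : ℝ) : ℝ → ℂ :=
  fun t => q.eval (t : ℂ) * (Real.exp (-c * t ^ 2) : ℂ)

/-- A system `S` of functions on `ℝ` is complete in `C([a, b])`: the linear span of the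
restrictions to `[a, b]` of its members is dense for the supremum norm. -/
def CompleteInC (a b : ℝ) (S : Set (ℝ → ℂ)) : Prop :=
  Dense (Submodule.span ℂ {g : C(Set.Icc a b, ℂ) | ∃ u ∈ S, ∀ t : Set.Icc a b, g t = u t} :
    Set C(Set.Icc a b, ℂ))

/-- A system `S` of functions on `ℝ` is complete in `L^p([a, b])` (Lebesgue measure): the linear
span of the classes of its members in `L^p([a, b])` is dense for the `L^p` norm. -/
def CompleteInLp (p : ℝ≥0∞) [Fact (1 ≤ p)] (a b : ℝ) (S : Set (ℝ → ℂ)) : Prop :=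
  Dense (Submodule.span ℂ {g : Lp ℂ p (volume.restrict (Set.Icc a b)) |
      ∃ u ∈ S, g =ᵐ[volume.restrict (Set.Icc a b)] u} :
    Set (Lp ℂ p (volume.restrict (Set.Icc a b))))

/-!
Up to the factor `exp (-c l ^ 2)`, the translate of `q φ` by `l` is
`q(t - l) exp (2 c l t - c t ^ 2)`. Hence, for a continuous functional `ℓ` on `C([a, b])`, the
function `F(z) = exp (c z ^ 2) ℓ((q φ)(· - z))` is entire of exponential type, and it
grows only polynomially along the imaginary axis; `ℓ` annihilates the system exactly when `F`
vanishes on `Λ`.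

*Divergence implies completeness.* After multiplication by an exponential and division by a power
of `1 + z`, each of `F(z)` and `F(-z)` is bounded in the half-plane `Re z > 0`, where its zeros must
satisfy the Blaschke condition; for real zeros away from the origin this is the convergence of
`∑ 1 / |l|`. So `F = 0` (`eq_zero_of_tsum_inv_eq_top`). It remains to see that
`ℓ((q φ)(· - z)) = 0` for all `z` forces `ℓ = 0`. Here `q φ = P(d/dt) φ` for a nonzero polynomial
`P` (`exists_aeval_gaussianDeriv_eq`). A linear factor of `P` can be removed: a solution of
`K' = -β K` is a multiple of an exponential, whereas `K(x) = ℓ((r φ)(· - x))` decays like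
a Gaussian on the real line. Thus `ℓ(φ(· - z)) = 0` for all `z`; differentiating, `ℓ` annihilates all products of a
polynomial and `φ`, and these are dense. Completeness in `C([a, b])` gives completeness in
`L^p([a, b])`, as continuous functions are dense there.

*Convergence implies incompleteness.* For `z₀ ∉ Λ`, densities `g` are constructed which annihilate
any prescribed finite set of translates, are bounded independently of that set, and satisfy
`∫ g u = 1` for one fixed `u` (`exists_annihilating_densities`); then `u` is not in the closed span.
With `g(t) = exp (c t ^ 2 - 2 c z₀ t) h(t)` this asks that the Laplace transform of `h` vanish to
high order at the points `2 c (l - z₀)`. Such an `h` arises from a bump function by repeated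
convolution with the three-point measures `δ_0 / 2 + (1 + α) / 4 δ_{-σ} + (1 - α) / 4 δ_σ`. The
Laplace transform of such a measure is `1` at `0` and, for `α = coth (σ μ / 2)`, it vanishes at `μ`;
its modulus on the imaginary axis is at most `1` if `α ^ 2 ≤ 2`, which holds if `σ |μ| ≥ 2`. So the
`L^1` norm of the Fourier transform of `h` does not grow, and the summability of `1 / |l|` allows
`σ` of order `1 / |μ|` while the support stays inside `[a, b]`. Finitely many exceptional `μ` only
cost a constant factor.
-/

/-! ### Zeros of functions of exponential type -/

/-- Schwarz lemma in the right half-plane: one zero `l` can be divided out of a bounded holomorphic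
function, by means of the Blaschke factor `(z - l) / (z + l)`, without increasing the bound. -/
theorem exists_eq_blaschke_mul {f : ℂ → ℂ} {M l : ℝ} (hl : 0 < l)
    (hd : DifferentiableOn ℂ f {z | 0 < z.re}) (hM : ∀ z : ℂ, 0 < z.re → ‖f z‖ ≤ M)
    (h0 : f l = 0) :
    ∃ g : ℂ → ℂ, DifferentiableOn ℂ g {z | 0 < z.re} ∧ (∀ z : ℂ, 0 < z.re → ‖g z‖ ≤ M) ∧
      ∀ z : ℂ, 0 < z.re → f z = (z - l) / (z + l) * g z := by
  have hU : IsOpen {z : ℂ | 0 < z.re} := isOpen_lt continuous_const Complex.continuous_re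
  have hlU : {z : ℂ | 0 < z.re} ∈ nhds (l : ℂ) := hU.mem_nhds (by simpa using hl)
  have hlc : (l : ℂ) ≠ 0 := by exact_mod_cast hl.ne'
  have hne : ∀ z : ℂ, 0 < z.re → z + l ≠ 0 := fun z hz h => by
    have := congrArg Complex.re h
    simp at this
    linarith
  have hgd : DifferentiableOn ℂ (fun z => dslope f l z * (z + l)) {z | 0 < z.re} :=
    ((Complex.differentiableOn_dslope hlU).2 hd).mul (by fun_prop)
  have hfac : ∀ z : ℂ, 0 < z.re → f z = (z - l) / (z + l) * (dslope f l z * (z + l)) := by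
    intro z hz
    have h1 := sub_smul_dslope f (l : ℂ) z
    rw [h0, sub_zero, smul_eq_mul] at h1
    rw [← h1]
    field_simp [hne z hz]
  -- The Cayley transform `w ↦ l (1 + w) / (1 - w)` reduces the bound to the Schwarz lemma.
  have hone : ∀ w : ℂ, w ∈ Metric.ball (0 : ℂ) 1 → 1 - w ≠ 0 := fun w hw h => by
    rw [mem_ball_zero_iff, ← sub_eq_zero.1 h] at hw
    simp at hw
  have hmaps : ∀ w : ℂ, w ∈ Metric.ball (0 : ℂ) 1 → 0 < ((l : ℂ) * ((1 + w) / (1 - w))).re := by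
    intro w hw
    have h2 : ‖w‖ ^ 2 < 1 := by
      have := mem_ball_zero_iff.1 hw
      nlinarith [norm_nonneg w]
    rw [Complex.sq_norm, Complex.normSq_apply] at h2
    have h3 : 0 < Complex.normSq (1 - w) := Complex.normSq_pos.2 (hone w hw)
    rw [Complex.re_ofReal_mul, Complex.div_re, ← add_div]
    refine mul_pos hl (div_pos ?_ h3)
    simp
    nlinarith
  have hpt : ∀ z : ℂ, 0 < z.re → ‖f z‖ ≤ M * ‖(z - l) / (z + l)‖ := by
    intro z hz
    have hw : (z - l) / (z + l) ∈ Metric.ball (0 : ℂ) 1 := by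
      rw [mem_ball_zero_iff, norm_div, div_lt_one (norm_pos_iff.2 (hne z hz)),
        ← sq_lt_sq₀ (norm_nonneg _) (norm_nonneg _), Complex.sq_norm, Complex.sq_norm,
        Complex.normSq_apply, Complex.normSq_apply]
      simp
      nlinarith [mul_pos hl hz]
    have hS := Complex.dist_le_div_mul_dist_of_mapsTo_ball (R₂ := M)
      (f := fun w => f (l * ((1 + w) / (1 - w)))) (c := 0) (R₁ := 1)
      (hd.comp (t := {z : ℂ | 0 < z.re})
        (DifferentiableOn.const_mul (DifferentiableOn.div (by fun_prop) (by fun_prop) hone) _)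
        hmaps)
      (by
        intro w hw
        simpa [h0] using hM _ (hmaps w hw)) hw
    have hz' : (l : ℂ) * ((1 + (z - l) / (z + l)) / (1 - (z - l) / (z + l))) = z := by
      have h1 : 1 - (z - l) / (z + l) ≠ 0 := hone _ hw
      have h2 := hne z hz
      have h3 : 1 - (z - l) / (z + l) = 2 * l / (z + l) := by field_simp; ring
      have h4 : 1 + (z - l) / (z + l) = 2 * z / (z + l) := by field_simp; ring
      rw [h3, h4]
      field_simp
    simpa [hz', h0] using hS
  have hoff : ∀ z : ℂ, 0 < z.re → z ≠ l → ‖dslope f l z * (z + l)‖ ≤ M := by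
    intro z hz hzl
    have h1 := hpt z hz
    rw [hfac z hz, norm_mul, mul_comm M] at h1
    refine le_of_mul_le_mul_left h1 (norm_pos_iff.2 (div_ne_zero (sub_ne_zero.2 hzl) (hne z hz)))
  refine ⟨fun z => dslope f l z * (z + l), hgd, ?_, hfac⟩
  intro z hz
  by_cases hzl : z = l
  · -- At `l` itself the quotient is given by a derivative; the bound persists by continuity.
    subst hzl
    have hc : ContinuousAt (fun z => dslope f l z * (z + l)) (l : ℂ) :=
      (hgd.differentiableAt hlU).continuousAt
    refine le_of_tendsto (hc.norm.tendsto.mono_left nhdsWithin_le_nhds :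
      Filter.Tendsto _ (nhdsWithin (l : ℂ) {(l : ℂ)}ᶜ) _) ?_
    filter_upwards [self_mem_nhdsWithin, mem_nhdsWithin_of_mem_nhds hlU] with w hw hw'
    exact hoff w hw' hw
  · exact hoff z hz hzl

/-- Dividing out finitely many zeros bounds a bounded holomorphic function in the right half-plane
by a finite Blaschke product. -/
theorem norm_le_prod_blaschke (S : Finset ℝ) {f : ℂ → ℂ} {M : ℝ} (hS : ∀ l ∈ S, 0 < l)
    (hd : DifferentiableOn ℂ f {z | 0 < z.re}) (hM : ∀ z : ℂ, 0 < z.re → ‖f z‖ ≤ M)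
    (h0 : ∀ l ∈ S, f l = 0) {z : ℂ} (hz : 0 < z.re) :
    ‖f z‖ ≤ M * ∏ l ∈ S, ‖(z - l) / (z + l)‖ := by
  induction S using Finset.induction_on generalizing f with
  | empty => simpa using hM z hz
  | insert l S hl ih =>
    obtain ⟨g, hgd, hgM, hg⟩ := exists_eq_blaschke_mul (hS l (by simp)) hd hM (h0 l (by simp))
    have := ih (fun k hk => hS k (by simp [hk])) hgd hgM (fun k hk => by
      have hk0 := hS k (by simp [hk])
      have h1 := hg k (by simpa using hk0)
      rw [h0 k (by simp [hk])] at h1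
      refine (mul_eq_zero.1 h1.symm).resolve_left (div_ne_zero ?_ ?_)
      · rw [sub_ne_zero]
        rintro h
        exact hl (by rw [← Complex.ofReal_inj.1 h]; exact hk)
      · have := hS l (by simp)
        exact_mod_cast (add_pos hk0 this).ne')
    rw [hg z hz, norm_mul, Finset.prod_insert hl]
    calc _ ≤ _ := mul_le_mul_of_nonneg_left this (norm_nonneg _)
      _ = _ := by ring

/-- The Blaschke condition: a bounded holomorphic function in the right half-plane whose zeros
`l ≥ 1` have a divergent sum of reciprocals vanishes on `(0, 1)`. -/
theorem eq_zero_of_unbounded_sum_inv {f : ℂ → ℂ} {M : ℝ} {Z : Set ℝ} (hZ : ∀ l ∈ Z, 1 ≤ l)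
    (hd : DifferentiableOn ℂ f {z | 0 < z.re}) (hM : ∀ z : ℂ, 0 < z.re → ‖f z‖ ≤ M)
    (h0 : ∀ l ∈ Z, f l = 0)
    (hdiv : ∀ R : ℝ, ∃ S : Finset ℝ, ↑S ⊆ Z ∧ R ≤ ∑ l ∈ S, 1 / l)
    {x : ℝ} (hx0 : 0 < x) (hx1 : x < 1) : f x = 0 := by
  have hM0 : 0 ≤ M := (norm_nonneg _).trans (hM 1 (by simp))
  have key : ∀ R : ℝ, ‖f x‖ ≤ M * Real.exp (-(x * R)) := by
    intro R
    obtain ⟨S, hSZ, hSR⟩ := hdiv R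
    have h1 := norm_le_prod_blaschke S (fun l hl => by linarith [hZ l (hSZ hl)]) hd hM
      (fun l hl => h0 l (hSZ hl)) (z := (x : ℂ)) (by simpa using hx0)
    refine h1.trans (mul_le_mul_of_nonneg_left ?_ hM0)
    calc ∏ l ∈ S, ‖((x : ℂ) - l) / (x + l)‖ ≤ ∏ l ∈ S, Real.exp (-(x * (1 / l))) := by
          refine Finset.prod_le_prod (fun _ _ => norm_nonneg _) fun l hl => ?_
          have hl1 := hZ l (hSZ hl)
          rw [← Complex.ofReal_sub, ← Complex.ofReal_add, ← Complex.ofReal_div,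
            Complex.norm_real, Real.norm_eq_abs, abs_div, abs_of_neg (by linarith : x - l < 0),
            abs_of_pos (by linarith : 0 < x + l)]
          refine le_trans ?_ (Real.add_one_le_exp _)
          rw [div_le_iff₀ (by linarith)]
          have : x * (1 / l) * l = x := by field_simp
          have h3 : x * (1 / l) ≤ 1 := by
            rw [mul_one_div, div_le_one (by linarith)]; linarith
          nlinarith
      _ = Real.exp (-(x * ∑ l ∈ S, 1 / l)) := by
          rw [← Real.exp_sum, Finset.sum_neg_distrib, Finset.mul_sum]
      _ ≤ _ := Real.exp_le_exp.2 (by nlinarith)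
  have hlim : Filter.Tendsto (fun R : ℝ => M * Real.exp (-(x * R))) Filter.atTop (nhds (M * 0)) :=
    (Real.tendsto_exp_neg_atTop_nhds_zero.comp
      (Filter.tendsto_id.const_mul_atTop hx0)).const_mul M
  rw [mul_zero] at hlim
  exact norm_le_zero_iff.1 (ge_of_tendsto' hlim key)

/-- The exponential growth is compensated by `exp (-A z)` and the polynomial growth by
`(1 + z) ^ d`, which has no zeros in the right half-plane. -/
theorem eq_zero_of_exponential_growth_of_unbounded_sum_inv {F : ℂ → ℂ} (hF : Differentiable ℂ F)
    {C A : ℝ} {d : ℕ} (hb : ∀ z : ℂ, ‖F z‖ ≤ C * (1 + ‖z‖) ^ d * Real.exp (A * |z.re|))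
    {Z : Set ℝ} (hZ : ∀ l ∈ Z, 1 ≤ l) (h0 : ∀ l ∈ Z, F l = 0)
    (hdiv : ∀ R : ℝ, ∃ S : Finset ℝ, ↑S ⊆ Z ∧ R ≤ ∑ l ∈ S, 1 / l) : F = 0 := by
  have hne : ∀ z : ℂ, 0 < z.re → 1 + z ≠ 0 := fun z hz h => by
    have := congrArg Complex.re h
    simp at this
    linarith
  have hC : 0 ≤ C := by
    have := (norm_nonneg _).trans (hb 0)
    simpa using this
  have hnorm : ∀ z : ℂ, 0 < z.re → 1 + ‖z‖ ≤ 2 * ‖1 + z‖ := by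
    intro z hz
    have h1 : 1 ≤ ‖1 + z‖ := by
      have := Complex.re_le_norm (1 + z)
      simp at this
      linarith
    have h2 : ‖z‖ ≤ ‖1 + z‖ := by
      rw [← sq_le_sq₀ (norm_nonneg _) (norm_nonneg _), Complex.sq_norm, Complex.sq_norm,
        Complex.normSq_apply, Complex.normSq_apply]
      simp
      nlinarith
    linarith
  have hz := fun (x : ℝ) (hx0 : 0 < x) (hx1 : x < 1) =>
    eq_zero_of_unbounded_sum_inv (f := fun z => F z * Complex.exp (-(A * z)) / (1 + z) ^ d)
      (M := C * 2 ^ d) hZ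
      (DifferentiableOn.div (by fun_prop) (by fun_prop) fun z hz => pow_ne_zero _ (hne z hz))
      (by
        intro z hz
        have hp : 0 < ‖1 + z‖ := norm_pos_iff.2 (hne z hz)
        rw [norm_div, norm_mul, norm_pow, div_le_iff₀ (pow_pos hp d), Complex.norm_exp]
        have h1 : (-(A * z) : ℂ).re = -(A * z.re) := by simp
        rw [h1]
        calc ‖F z‖ * Real.exp (-(A * z.re))
            ≤ C * (1 + ‖z‖) ^ d * Real.exp (A * |z.re|) * Real.exp (-(A * z.re)) :=
              mul_le_mul_of_nonneg_right (hb z) (Real.exp_pos _).le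
          _ = C * (1 + ‖z‖) ^ d := by
              rw [abs_of_pos hz, mul_assoc, ← Real.exp_add, add_neg_cancel, Real.exp_zero, mul_one]
          _ ≤ C * (2 * ‖1 + z‖) ^ d := by
              have := hnorm z hz
              gcongr
          _ = _ := by rw [mul_pow, mul_assoc])
      (fun l hl => by simp [h0 l hl]) hdiv hx0 hx1
  have hz' : ∀ x : ℝ, 0 < x → x < 1 → F x = 0 := by
    intro x hx0 hx1
    have h1 := hz x hx0 hx1
    rw [div_eq_zero_iff, mul_eq_zero] at h1
    rcases h1 with (h | h) | h
    · exact h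
    · exact absurd h (Complex.exp_ne_zero _)
    · exact absurd h (pow_ne_zero _ (hne x (by simpa using hx0)))
  have han : AnalyticOnNhd ℂ F Set.univ := hF.differentiableOn.analyticOnNhd isOpen_univ
  have hfreq : ∃ᶠ z : ℂ in nhdsWithin (1 / 2 : ℂ) {(1 / 2 : ℂ)}ᶜ, F z = 0 := by
    have ht : Filter.Tendsto (fun x : ℝ => (x : ℂ)) (nhdsWithin (1 / 2 : ℝ) {(1 / 2 : ℝ)}ᶜ)
        (nhdsWithin (1 / 2 : ℂ) {(1 / 2 : ℂ)}ᶜ) := by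
      refine tendsto_nhdsWithin_iff.2 ⟨?_, ?_⟩
      · have := (Complex.continuous_ofReal.tendsto (1 / 2 : ℝ))
        simp only [Complex.ofReal_div, Complex.ofReal_one, Complex.ofReal_ofNat] at this
        exact this.mono_left nhdsWithin_le_nhds
      · filter_upwards [self_mem_nhdsWithin] with x hx h
        refine hx ?_
        have : (x : ℂ) = ((1 / 2 : ℝ) : ℂ) := by simpa using h
        exact Complex.ofReal_inj.1 this
    refine ht.frequently (Filter.Eventually.frequently ?_)
    refine mem_nhdsWithin_of_mem_nhds ?_
    filter_upwards [Ioo_mem_nhds (a := (0 : ℝ)) (b := 1) (x := 1 / 2) (by norm_num) (by norm_num)]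
      with x hx
    exact hz' x hx.1 hx.2
  funext z
  exact han.eqOn_zero_of_preconnected_of_frequently_eq_zero isPreconnected_univ (Set.mem_univ _)
    hfreq (Set.mem_univ z)

theorem exists_finset_le_sum_of_tsum_eq_top {Z : Set ℝ} (f : ℝ → ℝ) (hf : ∀ l ∈ Z, 0 ≤ f l)
    (h : ∑' l : Z, ENNReal.ofReal (f l) = ∞) (R : ℝ) :
    ∃ S : Finset ℝ, ↑S ⊆ Z ∧ R ≤ ∑ l ∈ S, f l := by
  rw [ENNReal.tsum_eq_iSup_sum, iSup_eq_top] at h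
  obtain ⟨S, hS⟩ := h (ENNReal.ofReal R) ENNReal.ofReal_lt_top
  refine ⟨S.map (Function.Embedding.subtype _), ?_, ?_⟩
  · intro x hx
    simp at hx
    exact hx.1
  · rw [← ENNReal.ofReal_sum_of_nonneg (fun (i : Z) _ => hf i i.2)] at hS
    rw [Finset.sum_map]
    exact (ENNReal.ofReal_lt_ofReal_iff'.1 hS).1.le

/-- An entire function of exponential growth in the real direction and polynomial growth in the
imaginary direction vanishes identically as soon as it vanishes on a set of real numbers with a
divergent sum of reciprocals. -/
theorem eq_zero_of_tsum_inv_eq_top {F : ℂ → ℂ} (hF : Differentiable ℂ F)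
    {C A : ℝ} {d : ℕ} (hb : ∀ z : ℂ, ‖F z‖ ≤ C * (1 + ‖z‖) ^ d * Real.exp (A * |z.re|))
    {Λ : Set ℝ} (h0 : ∀ l ∈ Λ, F l = 0)
    (hdiv : ∑' l : {l : ℝ // l ∈ Λ ∧ l ≠ 0}, ENNReal.ofReal (1 / |(l : ℝ)|) = ∞) : F = 0 := by
  by_cases hfin : (Λ ∩ Set.Icc (-1) 1).Finite
  · -- The zeros in `[-1, 1]` contribute a finite sum, so one of the two half-lines diverges.
    let f : ℝ → ℝ≥0∞ := fun l => ENNReal.ofReal (1 / |l|)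
    have hsub : ∀ s : Set ℝ, ∑' l : s, f l = ∑' l, s.indicator f l := fun s => tsum_subtype s f
    have hle : ∑' l : {l : ℝ | l ∈ Λ ∧ l ≠ 0}, f l ≤
        (∑' l : ((Λ ∩ Set.Icc (-1) 1) \ {0} : Set ℝ), f l +
        ∑' l : {l | l ∈ Λ ∧ 1 ≤ l}, f l) + ∑' l : {l | l ∈ Λ ∧ 1 ≤ -l}, f l := by
      rw [hsub, hsub, hsub, hsub, ← ENNReal.tsum_add, ← ENNReal.tsum_add]
      refine ENNReal.tsum_le_tsum fun l => ?_
      by_cases hl : l ∈ Λ ∧ l ≠ 0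
      · rw [Set.indicator_of_mem (show l ∈ {l | l ∈ Λ ∧ l ≠ 0} from hl)]
        rcases le_or_gt 1 l with h1 | h1
        · rw [Set.indicator_of_mem (show l ∈ {l | l ∈ Λ ∧ 1 ≤ l} from ⟨hl.1, h1⟩)]
          exact le_add_right le_add_self
        rcases le_or_gt 1 (-l) with h2 | h2
        · rw [Set.indicator_of_mem (show l ∈ {l | l ∈ Λ ∧ 1 ≤ -l} from ⟨hl.1, h2⟩)]
          exact le_add_self
        · rw [Set.indicator_of_mem (show l ∈ (Λ ∩ Set.Icc (-1) 1) \ {0} from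
            ⟨⟨hl.1, by linarith, h1.le⟩, hl.2⟩)]
          exact le_add_right le_self_add
      · rw [Set.indicator_of_notMem (show l ∉ {l | l ∈ Λ ∧ l ≠ 0} from hl)]
        exact zero_le
    have hA : ∑' l : ((Λ ∩ Set.Icc (-1) 1) \ {0} : Set ℝ), f l ≠ ∞ := by
      have : Finite ((Λ ∩ Set.Icc (-1) 1) \ {0} : Set ℝ) := (hfin.subset Set.sdiff_subset)
      have := Fintype.ofFinite ((Λ ∩ Set.Icc (-1) 1) \ {0} : Set ℝ)
      rw [tsum_fintype]
      exact ENNReal.sum_ne_top.2 fun _ _ => ENNReal.ofReal_ne_top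
    have htop : ∑' l : {l : ℝ | l ∈ Λ ∧ l ≠ 0}, f l = ∞ := hdiv
    rw [htop, top_le_iff, ENNReal.add_eq_top, ENNReal.add_eq_top] at hle
    rcases hle with (h | h) | h
    · exact absurd h hA
    · refine eq_zero_of_exponential_growth_of_unbounded_sum_inv hF hb
        (Z := {l | l ∈ Λ ∧ 1 ≤ l}) (fun l hl => hl.2) (fun l hl => h0 l hl.1) fun R => ?_
      obtain ⟨S, hS, hR⟩ := exists_finset_le_sum_of_tsum_eq_top (fun l => 1 / |l|)
        (fun l _ => by positivity) h R
      refine ⟨S, hS, hR.trans_eq (Finset.sum_congr rfl fun l hl => ?_)⟩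
      rw [abs_of_nonneg (by linarith [(hS hl).2])]
    · have hG : (fun z => F (-z)) = 0 := by
        refine eq_zero_of_exponential_growth_of_unbounded_sum_inv (F := fun z => F (-z))
          (Z := {l | -l ∈ Λ ∧ 1 ≤ l}) (by fun_prop) (C := C) (A := A) (d := d)
          (fun z => by simpa using hb (-z)) (fun l hl => hl.2)
          (fun l hl => by simpa using h0 _ hl.1) fun R => ?_
        obtain ⟨S, hS, hR⟩ := exists_finset_le_sum_of_tsum_eq_top (fun l => 1 / |l|)
          (fun l _ => by positivity) h R
        refine ⟨S.map (Equiv.neg ℝ).toEmbedding, ?_, hR.trans_eq ?_⟩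
        · intro l hl
          simp only [Finset.coe_map, Set.mem_image] at hl
          obtain ⟨k, hk, rfl⟩ := hl
          simpa using hS hk
        · rw [Finset.sum_map]
          refine Finset.sum_congr rfl fun l hl => ?_
          rw [abs_of_neg (by linarith [(hS hl).2])]
          simp
      funext z
      simpa using congrFun hG (-z)
  · -- Infinitely many zeros in a compact set accumulate.
    obtain ⟨x, -, hx⟩ := Set.Infinite.exists_accPt_of_subset_isCompact hfin isCompact_Icc
      Set.inter_subset_right
    have han : AnalyticOnNhd ℂ F Set.univ := hF.differentiableOn.analyticOnNhd isOpen_univ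
    rw [accPt_iff_frequently_nhdsNE] at hx
    have ht : Filter.Tendsto (fun x : ℝ => (x : ℂ)) (nhdsWithin x {x}ᶜ)
        (nhdsWithin (x : ℂ) {(x : ℂ)}ᶜ) := by
      refine tendsto_nhdsWithin_iff.2
        ⟨(Complex.continuous_ofReal.tendsto x).mono_left nhdsWithin_le_nhds, ?_⟩
      filter_upwards [self_mem_nhdsWithin] with y hy h
      exact hy (Complex.ofReal_inj.1 h)
    funext z
    exact han.eqOn_zero_of_preconnected_of_frequently_eq_zero isPreconnected_univ
      (Set.mem_univ (x : ℂ)) (ht.frequently (hx.mono fun y hy => h0 y hy.1)) (Set.mem_univ z)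

/-! ### Polynomials times a Gaussian -/

/-- The operator `r ↦ r' - 2 c X r` on polynomials, which is differentiation of `r φ` read off on
the polynomial factor: `(r φ)' = (gaussianDeriv c r) φ` for `φ(t) = exp (-c t ^ 2)`. -/
noncomputable def gaussianDeriv (c : ℝ) : Module.End ℂ ℂ[X] :=
  derivative - (2 * c : ℂ) • LinearMap.mulLeft ℂ X

theorem gaussianDeriv_apply (c : ℝ) (r : ℂ[X]) :
    gaussianDeriv c r = derivative r - (2 * c : ℂ) • (X * r) := rfl

/-- Every function `q φ` is a constant-coefficient differential operator applied to `φ`. -/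
theorem exists_aeval_gaussianDeriv_eq {c : ℝ} (hc : c ≠ 0) (q : ℂ[X]) :
    ∃ P : ℂ[X], aeval (gaussianDeriv c) P 1 = q := by
  have hc2 : (2 * c : ℂ) ≠ 0 := by simpa using hc
  have hX : ∀ n : ℕ, ∃ P : ℂ[X], aeval (gaussianDeriv c) P 1 = X ^ n := by
    intro n
    induction n using Nat.strong_induction_on with
    | _ n ih =>
      rcases n with _ | n
      · exact ⟨1, by simp⟩
      · obtain ⟨P, hP⟩ := ih n (by omega)
        obtain ⟨Q, hQ⟩ := ih (n - 1) (by omega)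
        refine ⟨C ((2 * c : ℂ)⁻¹) * (C (n : ℂ) * Q - X * P), ?_⟩
        rw [map_mul, map_sub, map_mul, map_mul, aeval_C, aeval_C, aeval_X]
        simp only [Module.End.mul_apply, LinearMap.sub_apply, Module.algebraMap_end_apply, hP, hQ]
        rw [gaussianDeriv_apply, derivative_X_pow, ← smul_eq_C_mul, sub_sub_cancel, smul_smul,
          inv_mul_cancel₀ hc2, one_smul, pow_succ']
  induction q using Polynomial.induction_on' with
  | add p q hp hq =>
    obtain ⟨P, hP⟩ := hp
    obtain ⟨Q, hQ⟩ := hq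
    exact ⟨P + Q, by simp [hP, hQ]⟩
  | monomial n a =>
    obtain ⟨P, hP⟩ := hX n
    exact ⟨C a * P, by
      rw [map_mul, aeval_C, Module.End.mul_apply, Module.algebraMap_end_apply, hP,
        smul_X_eq_monomial]⟩

theorem exists_norm_eval_le (r : ℂ[X]) :
    ∃ C : ℝ, 0 ≤ C ∧ ∀ z : ℂ, ‖r.eval z‖ ≤ C * (1 + ‖z‖) ^ r.natDegree := by
  refine ⟨∑ i ∈ Finset.range (r.natDegree + 1), ‖r.coeff i‖,
    Finset.sum_nonneg fun _ _ => norm_nonneg _, fun z => ?_⟩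
  rw [eval_eq_sum_range, Finset.sum_mul]
  refine (norm_sum_le _ _).trans (Finset.sum_le_sum fun i hi => ?_)
  rw [norm_mul, norm_pow]
  refine mul_le_mul_of_nonneg_left ?_ (norm_nonneg _)
  calc ‖z‖ ^ i ≤ (1 + ‖z‖) ^ i := by gcongr; linarith
    _ ≤ _ := pow_le_pow_right₀ (by linarith [norm_nonneg z]) (by simp at hi; omega)

/-! ### Holomorphic families of translates -/

section BanachAlgebra

variable {𝔸 : Type*} [NormedCommRing 𝔸] [NormedAlgebra ℂ 𝔸]

/-- The expression `r(x - z) exp (-c (x - z) ^ 2)` in a Banach algebra. -/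
noncomputable def gaussianTranslateAt (x : 𝔸) (c : ℝ) (r : ℂ[X]) (z : ℂ) : 𝔸 :=
  aeval (x - algebraMap ℂ 𝔸 z) r * NormedSpace.exp (-(c : ℂ) • (x - algebraMap ℂ 𝔸 z) ^ 2)

theorem gaussianTranslateAt_add (x : 𝔸) (c : ℝ) (r s : ℂ[X]) (z : ℂ) :
    gaussianTranslateAt x c (r + s) z =
      gaussianTranslateAt x c r z + gaussianTranslateAt x c s z := by
  simp [gaussianTranslateAt, add_mul]

theorem gaussianTranslateAt_smul (x : 𝔸) (c : ℝ) (k : ℂ) (r : ℂ[X]) (z : ℂ) :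
    gaussianTranslateAt x c (k • r) z = k • gaussianTranslateAt x c r z := by
  simp [gaussianTranslateAt]

theorem gaussianTranslateAt_zero (x : 𝔸) (c : ℝ) (r : ℂ[X]) :
    gaussianTranslateAt x c r 0 = aeval x r * gaussianTranslateAt x c 1 0 := by
  simp [gaussianTranslateAt]

theorem isUnit_gaussianTranslateAt_one [CompleteSpace 𝔸] (x : 𝔸) (c : ℝ) (z : ℂ) :
    IsUnit (gaussianTranslateAt x c 1 z) := by
  have : NormedAlgebra ℚ 𝔸 := NormedAlgebra.restrictScalars ℚ ℂ 𝔸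
  rw [gaussianTranslateAt, map_one, one_mul]
  exact NormedSpace.isUnit_exp _

theorem hasDerivAt_gaussianTranslateAt [CompleteSpace 𝔸] (x : 𝔸) (c : ℝ) (r : ℂ[X]) (z : ℂ) :
    HasDerivAt (gaussianTranslateAt x c r) (-gaussianTranslateAt x c (gaussianDeriv c r) z) z := by
  have hw : HasDerivAt (fun z : ℂ => x - algebraMap ℂ 𝔸 z) (-1) z := by
    simp only [Algebra.algebraMap_eq_smul_one]
    simpa using ((hasDerivAt_id z).smul_const (1 : 𝔸)).const_sub x
  have hp : ∀ r : ℂ[X], HasDerivAt (fun z : ℂ => aeval (x - algebraMap ℂ 𝔸 z) r)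
      (-aeval (x - algebraMap ℂ 𝔸 z) (derivative r)) z := by
    intro r
    induction r using Polynomial.induction_on' with
    | add p q hp hq =>
      simp only [map_add]
      refine (hp.add hq).congr_deriv ?_
      ring
    | monomial n k =>
      simp only [aeval_monomial, derivative_monomial]
      refine ((hw.fun_pow n).const_mul (algebraMap ℂ 𝔸 k)).congr_deriv ?_
      simp only [map_mul, map_natCast]
      ring
  have he := (hasFDerivAt_exp (𝕂 := ℂ)
    (x := -(c : ℂ) • (x - algebraMap ℂ 𝔸 z) ^ 2)).comp_hasDerivAt z
    ((hw.fun_pow 2).const_smul (-(c : ℂ)))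
  refine ((hp r).mul he).congr_deriv ?_
  simp only [gaussianTranslateAt, gaussianDeriv_apply, Function.comp_apply, Pi.smul_apply,
    smul_apply, one_apply_eq_self, smul_eq_mul, map_sub, map_smul, map_mul, aeval_X, Nat.cast_ofNat]
  simp only [Algebra.smul_def, map_neg, map_mul, map_ofNat]
  ring

end BanachAlgebra

/-- The inclusion `[a, b] → ℂ`. -/
noncomputable def coordIcc (a b : ℝ) : C(Set.Icc a b, ℂ) :=
  ⟨fun t => ((t : ℝ) : ℂ), by fun_prop⟩

/-- The translate of `r φ` by a complex number `z`, as an element of `C([a, b])`. It is built with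
the exponential of the Banach algebra `C([a, b])`, so that it is visibly holomorphic in `z`. -/
noncomputable def gaussianTranslate (a b c : ℝ) (r : ℂ[X]) (z : ℂ) : C(Set.Icc a b, ℂ) :=
  gaussianTranslateAt (coordIcc a b) c r z

theorem gaussianTranslate_apply (a b c : ℝ) (r : ℂ[X]) (z : ℂ) (t : Set.Icc a b) :
    gaussianTranslate a b c r z t =
      r.eval (((t : ℝ) : ℂ) - z) * Complex.exp (-c * (((t : ℝ) : ℂ) - z) ^ 2) := by
  have : NormedAlgebra ℚ C(Set.Icc a b, ℂ) := NormedAlgebra.restrictScalars ℚ ℂ _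
  set ev := ContinuousMap.evalAlgHom ℂ ℂ t
  have hev : ∀ f, f t = ev f := fun f => rfl
  have hx : ev (coordIcc a b) = ((t : ℝ) : ℂ) := rfl
  have h := NormedSpace.map_exp ev
    (continuous_eval_const t) (-(c : ℂ) • (coordIcc a b - algebraMap ℂ _ z) ^ 2)
  rw [gaussianTranslate, gaussianTranslateAt, hev, map_mul, h, Complex.exp_eq_exp_ℂ,
    ← Polynomial.aeval_algHom_apply, map_smul, map_pow, map_sub, AlgHom.commutes, hx,
    Algebra.algebraMap_self_apply, smul_eq_mul, coe_aeval_eq_eval]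

theorem gaussianTranslate_add (a b c : ℝ) (r s : ℂ[X]) (z : ℂ) :
    gaussianTranslate a b c (r + s) z = gaussianTranslate a b c r z + gaussianTranslate a b c s z :=
  gaussianTranslateAt_add _ _ _ _ _

theorem gaussianTranslate_smul (a b c : ℝ) (k : ℂ) (r : ℂ[X]) (z : ℂ) :
    gaussianTranslate a b c (k • r) z = k • gaussianTranslate a b c r z :=
  gaussianTranslateAt_smul _ _ _ _ _

/-! ### Functionals annihilating all translates -/

section Functional

variable {a b c : ℝ} (ℓ : StrongDual ℂ C(Set.Icc a b, ℂ))

theorem hasDerivAt_dual_gaussianTranslate (r : ℂ[X]) (z : ℂ) :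
    HasDerivAt (fun z => ℓ (gaussianTranslate a b c r z))
      (-ℓ (gaussianTranslate a b c (gaussianDeriv c r) z)) z := by
  rw [← map_neg]
  exact ℓ.hasFDerivAt.comp_hasDerivAt z (hasDerivAt_gaussianTranslateAt (coordIcc a b) c r z)

/-- The function `z ↦ exp (c z ^ 2) ℓ(r φ(· - z))` is of exponential type, with only polynomial
growth along the imaginary axis. -/
theorem exists_norm_exp_mul_dual_le (hc : 0 < c) (r : ℂ[X]) :
    ∃ C A : ℝ, ∀ z : ℂ, ‖Complex.exp (c * z ^ 2) * ℓ (gaussianTranslate a b c r z)‖ ≤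
      C * (1 + ‖z‖) ^ r.natDegree * Real.exp (A * |z.re|) := by
  obtain ⟨C, hC, hr⟩ := exists_norm_eval_le r
  set R := max |a| |b|
  have hR : 0 ≤ R := (abs_nonneg a).trans (le_max_left _ _)
  refine ⟨‖ℓ‖ * (C * (1 + R) ^ r.natDegree), 2 * c * R, fun z => ?_⟩
  rw [← smul_eq_mul, ← map_smul]
  refine (ℓ.le_opNorm _).trans ?_
  rw [mul_assoc ‖ℓ‖, mul_assoc ‖ℓ‖]
  refine mul_le_mul_of_nonneg_left ?_ (norm_nonneg _)
  refine (ContinuousMap.norm_le _ (by positivity)).2 fun t => ?_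
  have ht : |(t : ℝ)| ≤ R := abs_le_max_abs_abs t.2.1 t.2.2
  rw [ContinuousMap.smul_apply, gaussianTranslate_apply, smul_eq_mul, mul_left_comm,
    ← Complex.exp_add, norm_mul, Complex.norm_exp]
  have hre : ((c : ℂ) * z ^ 2 + -c * (((t : ℝ) : ℂ) - z) ^ 2).re =
      2 * c * (t * z.re) - c * t ^ 2 := by
    have : (c : ℂ) * z ^ 2 + -c * (((t : ℝ) : ℂ) - z) ^ 2 =
      ((2 * c * t : ℝ) : ℂ) * z - ((c * t ^ 2 : ℝ) : ℂ) := by push_cast; ring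
    rw [this, Complex.sub_re, Complex.re_ofReal_mul, Complex.ofReal_re]
    ring
  rw [hre]
  have h1 : ‖r.eval (((t : ℝ) : ℂ) - z)‖ ≤ C * (1 + R) ^ r.natDegree * (1 + ‖z‖) ^ r.natDegree := by
    refine (hr _).trans ?_
    rw [mul_assoc, ← mul_pow]
    have h2 : ‖((t : ℝ) : ℂ) - z‖ ≤ R + ‖z‖ := by
      refine (norm_sub_le _ _).trans ?_
      rw [Complex.norm_real]
      exact add_le_add ht le_rfl
    refine mul_le_mul_of_nonneg_left (pow_le_pow_left₀ (by positivity) ?_ _) hC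
    nlinarith [norm_nonneg z, mul_nonneg hR (norm_nonneg z)]
  refine mul_le_mul h1 (Real.exp_le_exp.2 ?_) (Real.exp_pos _).le (by positivity)
  have h3 : (t : ℝ) * z.re ≤ R * |z.re| := by
    refine (le_abs_self _).trans ?_
    rw [abs_mul]
    gcongr
  have h4 : 0 ≤ c * (t : ℝ) ^ 2 := by positivity
  nlinarith

/-- On the real line `x ↦ ℓ(r φ(· - x))` decays like a Gaussian, so it is a multiple of an
exponential only if it is zero. -/
theorem eq_zero_of_dual_gaussianTranslate_eq_exp (hc : 0 < c) (r : ℂ[X]) (K β : ℂ)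
    (h : ∀ z, ℓ (gaussianTranslate a b c r z) = K * Complex.exp (β * z)) : K = 0 := by
  obtain ⟨C, A, hb⟩ := exists_norm_exp_mul_dual_le ℓ hc r
  set d := r.natDegree
  have hC : 0 ≤ C := by simpa using (norm_nonneg _).trans (hb 0)
  have key : ∀ x : ℝ, 0 ≤ x →
      ‖K‖ ≤ C * d.factorial * Real.exp (1 + (1 + A - β.re) * x - c * x ^ 2) := by
    intro x hx
    have h1 := hb x
    rw [h, norm_mul, norm_mul, Complex.norm_exp, Complex.norm_exp, Complex.norm_real,
      Complex.ofReal_re, Real.norm_eq_abs, abs_of_nonneg hx, Complex.re_mul_ofReal] at h1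
    have h2 : ((c : ℂ) * (x : ℂ) ^ 2).re = c * x ^ 2 := by
      rw [← Complex.ofReal_pow, ← Complex.ofReal_mul, Complex.ofReal_re]
    rw [h2] at h1
    have h3 : (1 + x) ^ d ≤ d.factorial * Real.exp (1 + x) := by
      have := Real.pow_div_factorial_le_exp (1 + x) (by linarith) d
      rwa [div_le_iff₀ (by positivity), mul_comm] at this
    have h4 : ‖K‖ * (Real.exp (c * x ^ 2) * Real.exp (β.re * x)) ≤
        C * (d.factorial * Real.exp (1 + x)) * Real.exp (A * x) := by
      calc _ = Real.exp (c * x ^ 2) * (‖K‖ * Real.exp (β.re * x)) := by ring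
        _ ≤ _ := h1
        _ ≤ _ := by gcongr
    rw [← Real.exp_add] at h4
    calc ‖K‖ = ‖K‖ * Real.exp (c * x ^ 2 + β.re * x) * Real.exp (-(c * x ^ 2 + β.re * x)) := by
          rw [mul_assoc, ← Real.exp_add]; simp
      _ ≤ C * (d.factorial * Real.exp (1 + x)) * Real.exp (A * x) *
            Real.exp (-(c * x ^ 2 + β.re * x)) := by gcongr
      _ = _ := by
          rw [mul_assoc, ← Real.exp_add, ← mul_assoc C, mul_assoc, ← Real.exp_add]
          ring_nf
  have hlim : Filter.Tendsto (fun x : ℝ => x * ((1 + A - β.re) - c * x)) Filter.atTop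
      Filter.atBot := by
    refine Filter.Tendsto.atTop_mul_atBot₀ Filter.tendsto_id ?_
    exact Filter.tendsto_atBot_add_const_left _ _
      (Filter.tendsto_neg_atTop_atBot.comp (Filter.tendsto_id.const_mul_atTop hc))
  have hlim2 := (Real.tendsto_exp_atBot.comp
    (Filter.tendsto_atBot_add_const_left _ 1 hlim)).const_mul (C * d.factorial)
  rw [mul_zero] at hlim2
  refine norm_le_zero_iff.1 (ge_of_tendsto hlim2 ?_)
  filter_upwards [Filter.eventually_ge_atTop 0] with x hx
  refine (key x hx).trans_eq ?_
  simp only [Function.comp_apply]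
  ring_nf

/-- A functional that annihilates all complex translates of `P(D) φ`, with `P ≠ 0`, annihilates all
complex translates of `φ`; the linear factors of `P` are removed one at a time. -/
theorem dual_gaussianTranslate_eq_zero_of_aeval (hc : 0 < c) (P : ℂ[X]) (hP : P ≠ 0)
    (h : ∀ z, ℓ (gaussianTranslate a b c (aeval (gaussianDeriv c) P 1) z) = 0) :
    ∀ z, ℓ (gaussianTranslate a b c 1 z) = 0 := by
  induction hn : P.natDegree generalizing P with
  | zero =>
    obtain ⟨k, rfl⟩ := natDegree_eq_zero.1 hn
    have hk : k ≠ 0 := by rintro rfl; simp at hP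
    intro z
    have := h z
    rw [aeval_C, Module.algebraMap_end_apply, gaussianTranslate_smul, map_smul, smul_eq_mul] at this
    exact (mul_eq_zero.1 this).resolve_left hk
  | succ n ih =>
    obtain ⟨β, hβ⟩ := IsAlgClosed.exists_root P (fun h0 => by
      rw [natDegree_eq_of_degree_eq_some (n := 0) h0] at hn; omega)
    obtain ⟨Q, rfl⟩ := dvd_iff_isRoot.2 hβ
    have hQ : Q ≠ 0 := right_ne_zero_of_mul hP
    refine ih Q hQ ?_ (by rw [natDegree_mul (X_sub_C_ne_zero β) hQ, natDegree_X_sub_C] at hn; omega)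
    -- `K` solves the first order equation `K' = -β K`.
    set r := aeval (gaussianDeriv c) Q 1
    set K : ℂ → ℂ := fun z => ℓ (gaussianTranslate a b c r z)
    have hd : ∀ z, HasDerivAt K (-β * K z) z := by
      intro z
      have h1 := hasDerivAt_dual_gaussianTranslate (c := c) ℓ r z
      have h2 := h z
      have h3 : aeval (gaussianDeriv c) ((X - C β) * Q) 1 = gaussianDeriv c r + (-β) • r := by
        rw [map_mul, map_sub, aeval_X, aeval_C, Module.End.mul_apply, LinearMap.sub_apply,
          Module.algebraMap_end_apply, neg_smul, sub_eq_add_neg]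
      rw [h3, gaussianTranslate_add, map_add, gaussianTranslate_smul, map_smul, smul_eq_mul] at h2
      have h4 : -ℓ (gaussianTranslate a b c (gaussianDeriv c r) z) = -β * K z := by
        rw [neg_eq_iff_add_eq_zero]; exact h2
      rwa [h4] at h1
    have hG : ∀ z, HasDerivAt (fun z => K z * Complex.exp (β * z)) 0 z := by
      intro z
      have h1 : HasDerivAt (fun z => Complex.exp (β * z)) (Complex.exp (β * z) * β) z := by
        simpa using ((hasDerivAt_id z).const_mul β).cexp
      refine ((hd z).mul h1).congr_deriv ?_
      ring
    have hconst : ∀ z, K z * Complex.exp (β * z) = K 0 := by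
      intro z
      have := is_const_of_deriv_eq_zero (fun z => (hG z).differentiableAt)
        (fun z => (hG z).deriv) z 0
      simpa using this
    have hexp : ∀ z, K z = K 0 * Complex.exp (-β * z) := by
      intro z
      rw [← hconst z, mul_assoc, ← Complex.exp_add]
      simp
    have hK0 := eq_zero_of_dual_gaussianTranslate_eq_exp ℓ hc r (K 0) (-β) hexp
    intro z
    exact (hexp z).trans (by rw [hK0, zero_mul])

/-- The translates of `φ` by all complex numbers are total in `C([a, b])`. -/
theorem dual_eq_zero_of_gaussianTranslate_one (hc : 0 < c)
    (h : ∀ z, ℓ (gaussianTranslate a b c 1 z) = 0) : ℓ = 0 := by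
  have hT : ∀ r : ℂ[X], (∀ z, ℓ (gaussianTranslate a b c r z) = 0) →
      ∀ z, ℓ (gaussianTranslate a b c (gaussianDeriv c r) z) = 0 := by
    intro r hr z
    have h1 := hasDerivAt_dual_gaussianTranslate (c := c) ℓ r z
    simp only [hr] at h1
    simpa using h1.unique (hasDerivAt_const z 0)
  have hP : ∀ P : ℂ[X], ∀ z,
      ℓ (gaussianTranslate a b c (aeval (gaussianDeriv c) P 1) z) = 0 := by
    intro P
    induction P using Polynomial.induction_on with
    | C k => intro z; simp [aeval_C, gaussianTranslate_smul, h]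
    | add p q hp hq => intro z; simp [gaussianTranslate_add, hp, hq]
    | monomial n k ih =>
      have h1 : aeval (gaussianDeriv c) (C k * X ^ (n + 1)) 1 =
          gaussianDeriv c (aeval (gaussianDeriv c) (C k * X ^ n) 1) := by
        rw [pow_succ', mul_left_comm, map_mul, aeval_X, Module.End.mul_apply]
      rw [h1]
      exact hT _ ih
  have hr : ∀ r : ℂ[X], ℓ (gaussianTranslate a b c r 0) = 0 := by
    intro r
    obtain ⟨P, rfl⟩ := exists_aeval_gaussianDeriv_eq hc.ne' r
    exact hP P 0
  -- Polynomials are dense, and multiplication by the Gaussian is invertible.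
  set e : C(Set.Icc a b, ℂ) := gaussianTranslate a b c 1 0
  have hdense : ∀ f : C(Set.Icc a b, ℂ), ℓ (f * e) = 0 := by
    have hstar : star (coordIcc a b) = coordIcc a b := by
      ext t
      simp [coordIcc]
    have htop := ContinuousMap.starSubalgebra_topologicalClosure_eq_top_of_separatesPoints
      (StarAlgebra.adjoin ℂ {coordIcc a b}) (by
        intro s t hst
        refine ⟨coordIcc a b, ⟨coordIcc a b, StarAlgebra.subset_adjoin ℂ _ rfl, rfl⟩, fun h => ?_⟩
        exact hst (Subtype.ext (Complex.ofReal_inj.1 h)))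
    have hcl : IsClosed {f : C(Set.Icc a b, ℂ) | ℓ (f * e) = 0} :=
      isClosed_eq (by fun_prop) continuous_const
    intro f
    have hf : f ∈ closure ((StarAlgebra.adjoin ℂ {coordIcc a b} : StarSubalgebra ℂ _) :
        Set C(Set.Icc a b, ℂ)) := by
      rw [← StarSubalgebra.topologicalClosure_coe, htop]
      trivial
    refine closure_minimal ?_ hcl hf
    intro g hg
    have hg' : g ∈ (StarAlgebra.adjoin ℂ {coordIcc a b}).toSubalgebra := hg
    rw [StarAlgebra.adjoin_toSubalgebra, Set.star_singleton, hstar, Set.union_self,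
      Algebra.adjoin_singleton_eq_range_aeval] at hg'
    obtain ⟨r, rfl⟩ := hg'
    have := hr r
    rwa [gaussianTranslate, gaussianTranslateAt_zero] at this
  ext f
  obtain ⟨v, hv⟩ := isUnit_gaussianTranslateAt_one (coordIcc a b) c 0
  have he : f = f * ↑v⁻¹ * e := by
    rw [show e = ↑v from hv.symm, Units.inv_mul_cancel_right]
  rw [he]
  simpa using hdense _

end Functional

/-! ### Completeness in the space of continuous functions -/

theorem Submodule.dense_of_forall_dual_eq_zero {E : Type*} [NormedAddCommGroup E] [NormedSpace ℂ E]
    (p : Submodule ℂ E) (h : ∀ ℓ : StrongDual ℂ E, (∀ x ∈ p, ℓ x = 0) → ℓ = 0) :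
    Dense (p : Set E) := by
  intro x
  by_contra hx
  have hcl : IsClosed (p.topologicalClosure : Set E) := p.isClosed_topologicalClosure
  obtain ⟨f, u, hfu, hux⟩ := RCLike.geometric_hahn_banach_closed_point (𝕜 := ℂ)
    (s := (p.topologicalClosure : Set E)) (p.topologicalClosure.restrictScalars ℝ).convex hcl hx
  have hf : f = 0 := by
    refine h f fun y hy => ?_
    by_contra hy0
    have h1 := hfu ((((u + 1 : ℝ) : ℂ) / f y) • y)
      (Submodule.smul_mem _ _ (p.le_topologicalClosure hy))
    rw [map_smul, smul_eq_mul, div_mul_cancel₀ _ hy0] at h1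
    simp at h1
    linarith
  have h0 := hfu 0 (Submodule.zero_mem _)
  rw [hf] at h0 hux
  simp at h0 hux
  linarith

theorem polyGaussian_sub_eq_gaussianTranslate (a b c : ℝ) (q : ℂ[X]) (l : ℝ) (t : Set.Icc a b) :
    polyGaussian q c (t - l) = gaussianTranslate a b c q l t := by
  rw [gaussianTranslate_apply, polyGaussian]
  push_cast
  rfl

theorem completeInC_of_tsum_inv_eq_top {q : ℂ[X]} (hq : q ≠ 0) {a b c : ℝ} (hc : 0 < c) {Λ : Set ℝ}
    (hdiv : ∑' l : {l : ℝ // l ∈ Λ ∧ l ≠ 0}, ENNReal.ofReal (1 / |(l : ℝ)|) = ∞) :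
    CompleteInC a b (translates (polyGaussian q c) Λ) := by
  refine Submodule.dense_of_forall_dual_eq_zero _ fun ℓ hℓ => ?_
  have h0 : ∀ l ∈ Λ, ℓ (gaussianTranslate a b c q l) = 0 := fun l hl =>
    hℓ _ (Submodule.subset_span ⟨_, ⟨l, hl, rfl⟩, fun t =>
      (polyGaussian_sub_eq_gaussianTranslate a b c q l t).symm⟩)
  obtain ⟨C, A, hb⟩ := exists_norm_exp_mul_dual_le ℓ hc q
  have hF : Differentiable ℂ fun z => ℓ (gaussianTranslate a b c q z) := fun z =>
    (hasDerivAt_dual_gaussianTranslate ℓ q z).differentiableAt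
  have hzero := eq_zero_of_tsum_inv_eq_top
    (F := fun z => Complex.exp (c * z ^ 2) * ℓ (gaussianTranslate a b c q z))
    (Differentiable.mul (by fun_prop) hF) hb (fun l hl => by simp [h0 l hl]) hdiv
  obtain ⟨P, hP⟩ := exists_aeval_gaussianDeriv_eq hc.ne' q
  refine dual_eq_zero_of_gaussianTranslate_one ℓ hc
    (dual_gaussianTranslate_eq_zero_of_aeval ℓ hc P ?_ fun z => ?_)
  · rintro rfl
    exact hq (by simpa using hP.symm)
  · rw [hP]
    exact (mul_eq_zero.1 (congrFun hzero z)).resolve_left (Complex.exp_ne_zero _)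

/-! ### From uniform to `L^p` approximation -/

/-- The continuous linear map `C([a, b]) → L^p([a, b])`, obtained by extending a continuous
function from `[a, b]` to a bounded continuous function on the line. -/
noncomputable def iccToLp {a b : ℝ} (hab : a ≤ b) (p : ℝ≥0∞) [Fact (1 ≤ p)] :
    C(Set.Icc a b, ℂ) →L[ℂ] Lp ℂ p (volume.restrict (Set.Icc a b)) :=
  (BoundedContinuousFunction.toLp p (volume.restrict (Set.Icc a b)) ℂ).comp
    (LinearMap.mkContinuous
      ({ toFun := fun f => (BoundedContinuousFunction.mkOfCompact f).compContinuous
          ⟨Set.projIcc a b hab, continuous_projIcc⟩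
         map_add' := fun _ _ => rfl
         map_smul' := fun _ _ => rfl} :
        C(Set.Icc a b, ℂ) →ₗ[ℂ] BoundedContinuousFunction ℝ ℂ) 1 fun f => by
      rw [one_mul]
      exact (BoundedContinuousFunction.norm_le (norm_nonneg _)).2 fun t => f.norm_coe_le_norm _)

theorem iccToLp_ae_eq {a b : ℝ} (hab : a ≤ b) (p : ℝ≥0∞) [Fact (1 ≤ p)] {f : C(Set.Icc a b, ℂ)}
    {u : ℝ → ℂ} (h : ∀ t : Set.Icc a b, f t = u t) :
    iccToLp hab p f =ᵐ[volume.restrict (Set.Icc a b)] u := by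
  have h1 : iccToLp hab p f =ᵐ[volume.restrict (Set.Icc a b)] fun t => f (Set.projIcc a b hab t) :=
    BoundedContinuousFunction.coeFn_toLp (𝕜 := ℂ) p (volume.restrict (Set.Icc a b))
      ((BoundedContinuousFunction.mkOfCompact f).compContinuous
        ⟨Set.projIcc a b hab, continuous_projIcc⟩)
  filter_upwards [h1, ae_restrict_mem measurableSet_Icc] with t h2 ht
  rw [h2, h, Set.projIcc_of_mem hab ht]

theorem denseRange_iccToLp {a b : ℝ} (hab : a ≤ b) (p : ℝ≥0∞) [Fact (1 ≤ p)] (hp : p ≠ ∞) :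
    DenseRange (iccToLp hab p) := by
  refine (BoundedContinuousFunction.toLp_denseRange ℂ (volume.restrict (Set.Icc a b)) ℂ hp).mono ?_
  rintro _ ⟨g, rfl⟩
  refine ⟨g.toContinuousMap.restrict _, Lp.ext ?_⟩
  exact (iccToLp_ae_eq hab p (u := g) fun t => rfl).trans
    (BoundedContinuousFunction.coeFn_toLp (𝕜 := ℂ) p _ g).symm

theorem CompleteInC.completeInLp {a b : ℝ} (hab : a ≤ b) {S : Set (ℝ → ℂ)} (h : CompleteInC a b S)
    (p : ℝ≥0∞) [Fact (1 ≤ p)] (hp : p ≠ ∞) : CompleteInLp p a b S := by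
  refine ((denseRange_iccToLp hab p hp).dense_image (iccToLp hab p).continuous h).mono ?_
  rintro _ ⟨f, hf, rfl⟩
  refine (Submodule.map_span_le (iccToLp hab p).toLinearMap _ _).2 ?_
    (Submodule.mem_map_of_mem hf)
  rintro g ⟨u, hu, hgu⟩
  exact Submodule.subset_span ⟨u, hu, iccToLp_ae_eq hab p hgu⟩

/-! ### Three-point convolutions -/

/-- The function `h` is continuous, supported in `[x - ρ, x + ρ]`, and it is the Fourier transform
of an integrable function of `L^1` norm at most `B`. -/
structure IsFourierBounded (h : ℝ → ℂ) (x ρ B : ℝ) : Prop where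
  continuous : Continuous h
  eq_zero : ∀ t, ρ < |t - x| → h t = 0
  exists_fourier : ∃ w : ℝ → ℂ, Integrable w ∧ ∫ y, ‖w y‖ ≤ B ∧
    ∀ t : ℝ, h t = ∫ y : ℝ, Complex.exp (Complex.I * y * t) * w y

namespace IsFourierBounded

variable {h : ℝ → ℂ} {x ρ B : ℝ}

theorem hasCompactSupport (hh : IsFourierBounded h x ρ B) : HasCompactSupport h :=
  HasCompactSupport.intro (isCompact_closedBall x ρ) fun t ht => hh.eq_zero t (by
    simpa [Real.dist_eq] using ht)

theorem integrable_mul (hh : IsFourierBounded h x ρ B) {k : ℝ → ℂ} (hk : Continuous k) :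
    Integrable fun t => k t * h t :=
  (hk.mul hh.continuous).integrable_of_hasCompactSupport hh.hasCompactSupport.mul_left

theorem norm_le (hh : IsFourierBounded h x ρ B) (t : ℝ) : ‖h t‖ ≤ B := by
  obtain ⟨w, -, hwB, hw⟩ := hh.exists_fourier
  rw [hw]
  refine (norm_integral_le_integral_norm _).trans (le_of_eq_of_le ?_ hwB)
  congr 1
  ext y
  rw [norm_mul, Complex.norm_exp]
  simp

theorem mono {ρ' B' : ℝ} (hh : IsFourierBounded h x ρ B) (hρ : ρ ≤ ρ') (hB : B ≤ B') :
    IsFourierBounded h x ρ' B' := by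
  obtain ⟨w, h1, h2, h3⟩ := hh.exists_fourier
  exact ⟨hh.continuous, fun t ht => hh.eq_zero t (hρ.trans_lt ht), w, h1, h2.trans hB, h3⟩

end IsFourierBounded

/-- The Laplace transform `z ↦ ∫ exp (z t) h(t) dt`. -/
noncomputable def laplace (h : ℝ → ℂ) (z : ℂ) : ℂ := ∫ t : ℝ, Complex.exp (z * t) * h t

theorem integral_mul_add_mul_add_mul {u v w : ℝ → ℂ} (hu : Integrable u) (hv : Integrable v)
    (hw : Integrable w) (i j k : ℂ) :
    ∫ t, (i * u t + j * v t + k * w t) = i * (∫ t, u t) + j * (∫ t, v t) + k * ∫ t, w t := by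
  have huv : Integrable fun t => i * u t + j * v t := (hu.const_mul i).add (hv.const_mul j)
  rw [integral_add huv (hw.const_mul k), integral_add (hu.const_mul i) (hv.const_mul j),
    integral_const_mul, integral_const_mul, integral_const_mul]

/-- Convolution with the three-point measure `δ_0 / 2 + (1 + α) / 4 δ_{-σ} + (1 - α) / 4 δ_σ`. -/
noncomputable def threePoint (σ α : ℝ) (h : ℝ → ℂ) : ℝ → ℂ := fun t =>
  1 / 2 * h t + (1 + α) / 4 * h (t + σ) + (1 - α) / 4 * h (t - σ)

/-- The Laplace transform of the measure of `threePoint`. -/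
noncomputable def threePointSymbol (σ α : ℝ) (z : ℂ) : ℂ :=
  1 / 2 + (1 + α) / 4 * Complex.exp (-(σ * z)) + (1 - α) / 4 * Complex.exp (σ * z)

open Classical in
/-- A bound for `threePointSymbol σ α` on the imaginary axis; it is `1` as soon as `α ^ 2 ≤ 2`. -/
noncomputable def threePointBound (α : ℝ) : ℝ := if α ^ 2 ≤ 2 then 1 else 1 + |α|

theorem threePointBound_nonneg (α : ℝ) : 0 ≤ threePointBound α := by
  unfold threePointBound
  split_ifs <;> positivity

theorem threePointSymbol_zero (σ α : ℝ) : threePointSymbol σ α 0 = 1 := by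
  simp [threePointSymbol]
  ring

theorem differentiable_threePointSymbol (σ α : ℝ) : Differentiable ℂ (threePointSymbol σ α) := by
  unfold threePointSymbol
  fun_prop

theorem norm_threePointSymbol_I_le (σ α y : ℝ) :
    ‖threePointSymbol σ α (Complex.I * y)‖ ≤ threePointBound α := by
  -- `m = (1 + cos θ) / 2 - i α sin θ / 2` with `θ = σ y`
  have hm : threePointSymbol σ α (Complex.I * y) =
      (((1 + Real.cos (σ * y)) / 2 : ℝ) : ℂ) +
        ((-(α * Real.sin (σ * y)) / 2 : ℝ) : ℂ) * Complex.I := by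
    have h1 : (σ : ℂ) * (Complex.I * y) = ((σ * y : ℝ) : ℂ) * Complex.I := by push_cast; ring
    rw [threePointSymbol, h1, ← neg_mul, ← Complex.ofReal_neg, Complex.exp_mul_I, Complex.exp_mul_I,
      ← Complex.ofReal_cos, ← Complex.ofReal_cos, ← Complex.ofReal_sin, ← Complex.ofReal_sin,
      Real.cos_neg, Real.sin_neg]
    push_cast
    ring
  have hB := threePointBound_nonneg α
  refine abs_le_of_sq_le_sq' ?_ hB |>.2
  rw [hm, Complex.sq_norm, Complex.normSq_add_mul_I]
  have hcs := Real.sin_sq_add_cos_sq (σ * y)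
  have hc1 := Real.cos_le_one (σ * y)
  have hc2 := Real.neg_one_le_cos (σ * y)
  set u := Real.cos (σ * y)
  set s := Real.sin (σ * y)
  have e : (-(α * s) / 2) ^ 2 = α ^ 2 * (1 - u ^ 2) / 4 := by
    rw [← hcs]; ring
  rw [e]
  have hu : 0 ≤ 1 - u ^ 2 := by nlinarith
  unfold threePointBound
  split_ifs with hα
  · nlinarith [mul_le_mul_of_nonneg_right hα hu, sq_nonneg (1 - u)]
  · have h1 : (1 + |α|) ^ 2 = 1 + 2 * |α| + α ^ 2 := by rw [add_sq, sq_abs]; ring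
    rw [h1]
    nlinarith [abs_nonneg α, mul_nonneg (sq_nonneg α) (sq_nonneg u), sq_nonneg α]

theorem IsFourierBounded.threePoint {h : ℝ → ℂ} {x ρ B : ℝ} (hh : IsFourierBounded h x ρ B)
    {σ : ℝ} (hσ : 0 ≤ σ) (α : ℝ) :
    IsFourierBounded (threePoint σ α h) x (ρ + σ) (threePointBound α * B) := by
  obtain ⟨w, hw, hwB, hrep⟩ := hh.exists_fourier
  have hcont := hh.continuous
  refine ⟨by unfold _root_.threePoint; fun_prop, fun t ht => ?_, ?_⟩
  · have h1 := abs_sub_abs_le_abs_sub (t - x) (-σ)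
    have h2 := abs_sub_abs_le_abs_sub (t - x) σ
    rw [abs_neg, abs_of_nonneg hσ] at h1
    rw [abs_of_nonneg hσ] at h2
    have e1 : t + σ - x = t - x - -σ := by ring
    have e2 : t - σ - x = t - x - σ := by ring
    rw [_root_.threePoint, hh.eq_zero t (by linarith), hh.eq_zero (t + σ) (by rw [e1]; linarith),
      hh.eq_zero (t - σ) (by rw [e2]; linarith)]
    simp
  · have hm : Continuous fun y : ℝ => threePointSymbol σ α (-(Complex.I * y)) :=
      (differentiable_threePointSymbol σ α).continuous.comp (by fun_prop)
    have hmle : ∀ y : ℝ, ‖threePointSymbol σ α (-(Complex.I * y))‖ ≤ threePointBound α := by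
      intro y
      have := norm_threePointSymbol_I_le σ α (-y)
      simpa using this
    have hexp : ∀ t : ℝ, Integrable fun y : ℝ => Complex.exp (Complex.I * y * t) * w y := fun t =>
      hw.bdd_mul (f := fun y : ℝ => Complex.exp (Complex.I * y * t)) (c := 1) (by fun_prop)
        (Filter.Eventually.of_forall fun y : ℝ => by
        rw [Complex.norm_exp]; simp)
    refine ⟨fun y : ℝ => threePointSymbol σ α (-(Complex.I * y)) * w y,
      hw.bdd_mul hm.aestronglyMeasurable (Filter.Eventually.of_forall hmle), ?_, fun t => ?_⟩
    · calc ∫ y : ℝ, ‖threePointSymbol σ α (-(Complex.I * y)) * w y‖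
          ≤ ∫ y, threePointBound α * ‖w y‖ := by
            refine integral_mono_of_nonneg (Filter.Eventually.of_forall fun y => norm_nonneg _)
              (hw.norm.const_mul _) (Filter.Eventually.of_forall fun y => ?_)
            simp only [norm_mul]
            exact mul_le_mul_of_nonneg_right (hmle y) (norm_nonneg _)
        _ = threePointBound α * ∫ y, ‖w y‖ := integral_const_mul _ _
        _ ≤ _ := mul_le_mul_of_nonneg_left hwB (threePointBound_nonneg α)
    · rw [_root_.threePoint, hrep, hrep, hrep,
        ← integral_mul_add_mul_add_mul (hexp t) (hexp _) (hexp _)]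
      congr 1
      ext y
      simp only [threePointSymbol]
      have e1 : Complex.exp (Complex.I * y * (t + σ : ℝ)) =
          Complex.exp (Complex.I * y * t) * Complex.exp (-(σ * -(Complex.I * y))) := by
        rw [← Complex.exp_add]; push_cast; ring_nf
      have e2 : Complex.exp (Complex.I * y * (t - σ : ℝ)) =
          Complex.exp (Complex.I * y * t) * Complex.exp (σ * -(Complex.I * y)) := by
        rw [← Complex.exp_add]; push_cast; ring_nf
      rw [e1, e2]
      ring

theorem laplace_threePoint {h : ℝ → ℂ} {x ρ B : ℝ} (hh : IsFourierBounded h x ρ B)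
    (σ α : ℝ) (z : ℂ) :
    laplace (threePoint σ α h) z = threePointSymbol σ α z * laplace h z := by
  have hint := hh.integrable_mul (k := fun t : ℝ => Complex.exp (z * t)) (by fun_prop)
  have hshift : ∀ s : ℝ, Integrable (fun t : ℝ => Complex.exp (z * t) * h (t + s)) ∧
      ∫ t : ℝ, Complex.exp (z * t) * h (t + s) = Complex.exp (-(s * z)) * laplace h z := by
    intro s
    have e : (fun t : ℝ => Complex.exp (z * t) * h (t + s)) =
        fun t => Complex.exp (-(s * z)) * (fun t : ℝ => Complex.exp (z * t) * h t) (t + s) := by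
      ext t
      simp only
      rw [← mul_assoc, ← Complex.exp_add]
      push_cast
      ring_nf
    rw [e]
    refine ⟨(hint.comp_add_right s).const_mul _, ?_⟩
    rw [integral_const_mul, integral_add_right_eq_self (fun t : ℝ => Complex.exp (z * t) * h t)]
    rfl
  have h1 := hshift σ
  have h2 := hshift (-σ)
  simp only [← sub_eq_add_neg] at h2
  have e : ∀ t : ℝ, Complex.exp (z * t) * threePoint σ α h t =
      1 / 2 * (Complex.exp (z * t) * h t) + (1 + α) / 4 * (Complex.exp (z * t) * h (t + σ)) +
        (1 - α) / 4 * (Complex.exp (z * t) * h (t - σ)) := fun t => by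
    rw [threePoint]; ring
  rw [laplace, integral_congr_ae (Filter.Eventually.of_forall e),
    integral_mul_add_mul_add_mul hint h1.1 h2.1, h1.2, h2.2, threePointSymbol, laplace]
  push_cast
  rw [neg_mul, neg_neg]
  ring

/-- The value `coth (s / 2)` of the parameter for which the symbol of `threePoint σ` vanishes at
`s / σ`. -/
noncomputable def cothHalf (s : ℝ) : ℝ := (Real.exp s + 1) / (Real.exp s - 1)

theorem threePointSymbol_cothHalf {σ μ : ℝ} (h : σ * μ ≠ 0) :
    threePointSymbol σ (cothHalf (σ * μ)) μ = 0 := by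
  have h1 : Real.exp (σ * μ) - 1 ≠ 0 := by
    rw [sub_ne_zero, Ne, Real.exp_eq_one_iff]; exact h
  have h2 : threePointSymbol σ (cothHalf (σ * μ)) μ =
      ((1 / 2 + (1 + cothHalf (σ * μ)) / 4 * (Real.exp (σ * μ))⁻¹ +
        (1 - cothHalf (σ * μ)) / 4 * Real.exp (σ * μ) : ℝ) : ℂ) := by
    rw [threePointSymbol, Complex.exp_neg]
    push_cast
    rfl
  rw [h2, Complex.ofReal_eq_zero, cothHalf]
  have h3 := (Real.exp_pos (σ * μ)).ne'
  field_simp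
  ring

/-- `coth (s / 2) ^ 2 ≤ 2` as soon as `exp |s| ≥ 3 + 2 √2`, which is smaller than `exp 2`. -/
theorem threePointBound_cothHalf {s : ℝ} (h : 2 ≤ |s|) : threePointBound (cothHalf s) = 1 := by
  have h7 : 7 ≤ Real.exp 2 := by
    have := Real.exp_one_gt_d9
    have h2 : Real.exp 2 = Real.exp 1 * Real.exp 1 := by rw [← Real.exp_add]; norm_num
    nlinarith
  have hx := Real.exp_pos s
  rw [threePointBound, if_pos]
  have key : 0 < (Real.exp s - 1) ^ 2 ∧ (Real.exp s + 1) ^ 2 ≤ 2 * (Real.exp s - 1) ^ 2 := by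
    rcases le_abs.1 h with h | h
    · have : 7 ≤ Real.exp s := h7.trans (Real.exp_le_exp.2 h)
      constructor <;> nlinarith
    · have h8 : 7 ≤ Real.exp (-s) := h7.trans (Real.exp_le_exp.2 h)
      have h9 : Real.exp s * Real.exp (-s) = 1 := by rw [← Real.exp_add]; simp
      have h10 : Real.exp s * 7 ≤ 1 := by nlinarith
      constructor <;> nlinarith
  rw [cothHalf, div_pow, div_le_iff₀ key.1]
  exact key.2

theorem exists_isFourierBounded (x : ℝ) {δ : ℝ} (hδ : 0 < δ) :
    ∃ h B, IsFourierBounded h x δ B ∧ laplace h 0 = 1 := by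
  let φ : ContDiffBump x := ⟨δ / 2, δ, by linarith, by linarith⟩
  let f : ℝ → ℂ := fun t => ((φ.normed volume t : ℝ) : ℂ)
  have hf : ContDiff ℝ (⊤ : ℕ∞) f := Complex.ofRealCLM.contDiff.comp φ.contDiff_normed
  have hfs : HasCompactSupport f := φ.hasCompactSupport_normed.comp_left Complex.ofReal_zero
  let F : SchwartzMap ℝ ℂ := hfs.toSchwartzMap hf
  have hF : ∀ t, F t = f t := fun t => rfl
  let G : SchwartzMap ℝ ℂ := FourierTransform.fourier F
  have hG : ∀ y, G y = FourierTransform.fourier (F : ℝ → ℂ) y := fun y => by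
    rw [SchwartzMap.fourier_coe]
  have hinv : ∀ t, f t = ∫ y : ℝ, Complex.exp (2 * Real.pi * Complex.I * y * t) * G y := by
    intro t
    have h1 := Continuous.fourierInv_fourier_eq F.continuous F.integrable (by
      rw [← SchwartzMap.fourier_coe]; exact G.integrable)
    have h2 := congrFun h1 t
    rw [← hF, ← h2, Real.fourierInv_eq']
    congr 1
    ext y
    rw [smul_eq_mul, hG]
    congr 2
    simp
    ring
  -- rescaling the frequency variable by `2 π`
  have hpi : (2 * Real.pi) ≠ 0 := by positivity
  have hc : Continuous f := hf.continuous
  let w : ℝ → ℂ := fun y => ((2 * Real.pi)⁻¹ : ℝ) * G ((2 * Real.pi)⁻¹ * y)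
  refine ⟨f, ∫ y, ‖w y‖, ⟨hc, fun t ht => ?_, w,
    (G.integrable.comp_mul_left' (inv_ne_zero hpi)).const_mul _, le_rfl, fun t => ?_⟩, ?_⟩
  · have : φ.normed volume t = 0 := by
      rw [← Function.notMem_support, φ.support_normed_eq, Metric.mem_ball, Real.dist_eq]
      exact not_lt.2 ht.le
    simp [f, this]
  · have h1 := Measure.integral_comp_mul_left
      (fun y : ℝ => Complex.exp (Complex.I * y * t) * G ((2 * Real.pi)⁻¹ * y)) (2 * Real.pi)
    rw [hinv]
    have h2 : ∀ y : ℝ, Complex.exp (2 * Real.pi * Complex.I * y * t) * G y =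
        Complex.exp (Complex.I * (2 * Real.pi * y : ℝ) * t) *
          G ((2 * Real.pi)⁻¹ * (2 * Real.pi * y)) := fun y => by
      rw [inv_mul_cancel_left₀ hpi]
      push_cast
      ring_nf
    simp only [h2, h1, w]
    rw [abs_of_pos (by positivity), Complex.real_smul, ← integral_const_mul]
    congr 1
    ext y
    ring
  · have h1 := φ.integral_normed (μ := volume)
    simp only [laplace, zero_mul, Complex.exp_zero, one_mul, f]
    rw [integral_complex_ofReal, h1, Complex.ofReal_one]

/-! ### Densities annihilating finitely many translates -/

theorem IsFourierBounded.exists_threePoint_iterate {h : ℝ → ℂ} {x ρ B : ℝ}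
    (hh : IsFourierBounded h x ρ B) {σ : ℝ} (hσ : 0 ≤ σ) (α : ℝ) (n : ℕ) :
    ∃ k, IsFourierBounded k x (ρ + n * σ) (threePointBound α ^ n * B) ∧
      ∀ z, laplace k z = threePointSymbol σ α z ^ n * laplace h z := by
  induction n with
  | zero => exact ⟨h, by simpa using hh, by simp⟩
  | succ n ih =>
    obtain ⟨k, hk, hkl⟩ := ih
    refine ⟨_root_.threePoint σ α k, ?_, fun z => ?_⟩
    · convert hk.threePoint hσ α using 1
      · push_cast; ring
      · ring
    · rw [laplace_threePoint hk, hkl]; ring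

/-- Convolution with `n` three-point measures for each element of a finite set `S`. -/
theorem IsFourierBounded.exists_threePoint_prod {h : ℝ → ℂ} {x ρ B : ℝ}
    (hh : IsFourierBounded h x ρ B) (S : Finset ℝ) {σ : ℝ → ℝ} (hσ : ∀ l ∈ S, 0 ≤ σ l)
    (α : ℝ → ℝ) (n : ℕ) :
    ∃ k, IsFourierBounded k x (ρ + n * ∑ l ∈ S, σ l) ((∏ l ∈ S, threePointBound (α l) ^ n) * B) ∧
      ∀ z, laplace k z = (∏ l ∈ S, threePointSymbol (σ l) (α l) z ^ n) * laplace h z := by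
  induction S using Finset.induction_on with
  | empty => exact ⟨h, by simpa using hh, by simp⟩
  | insert l S hl ih =>
    obtain ⟨k, hk, hkl⟩ := ih fun m hm => hσ m (by simp [hm])
    obtain ⟨k', hk', hkl'⟩ := hk.exists_threePoint_iterate (hσ l (by simp)) (α l) n
    refine ⟨k', ?_, fun z => ?_⟩
    · convert hk' using 1
      · rw [Finset.sum_insert hl]; ring
      · rw [Finset.prod_insert hl]; ring
    · rw [hkl', hkl, Finset.prod_insert hl]; ring

/-- A choice of widths `σ l` of arbitrarily small total length, with `σ l |μ l| ≥ 2` outside a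
finite set, for a family of frequencies `μ l` with summable reciprocals. -/
theorem exists_widths {Λ : Set ℝ} {μ : ℝ → ℝ} (hμ : ∀ l ∈ Λ, μ l ≠ 0)
    (hs : Summable fun l : Λ => 1 / |μ l|) {ε : ℝ} (hε : 0 < ε) :
    ∃ (σ : ℝ → ℝ) (T : Finset ℝ), ↑T ⊆ Λ ∧ (∀ l ∈ Λ, 0 < σ l) ∧
      (∀ l ∈ Λ, l ∉ T → 2 ≤ |σ l * μ l|) ∧ ∀ S : Finset ℝ, ↑S ⊆ Λ → ∑ l ∈ S, σ l ≤ ε := by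
  classical
  obtain ⟨s, hs⟩ := summable_iff_vanishing_norm.1 hs (ε / 4) (by positivity)
  let T : Finset ℝ := s.map (Function.Embedding.subtype _)
  have hT : ↑T ⊆ Λ := by
    intro x hx
    simp only [T, Finset.coe_map, Set.mem_image] at hx
    obtain ⟨y, -, rfl⟩ := hx
    exact y.2
  let η : ℝ := ε / (2 * (T.card + 1))
  have hη : 0 < η := by positivity
  refine ⟨fun l => if l ∈ T then η else 2 / |μ l|, T, hT, fun l hl => ?_, fun l hl hlT => ?_,
    fun S hS => ?_⟩
  · have := abs_pos.2 (hμ l hl)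
    dsimp only
    split_ifs <;> positivity
  · have := abs_pos.2 (hμ l hl)
    simp only [if_neg hlT]
    rw [abs_mul, abs_div, abs_abs, abs_two, div_mul_cancel₀ _ this.ne']
  · rw [Finset.sum_ite, Finset.sum_const, nsmul_eq_mul]
    have h1 : ((S.filter (· ∈ T)).card : ℝ) * η ≤ ε / 2 := by
      have : ((S.filter (· ∈ T)).card : ℝ) ≤ T.card := by
        exact_mod_cast Finset.card_le_card fun x hx => (Finset.mem_filter.1 hx).2
      calc _ ≤ ((T.card : ℝ) + 1) * η := by gcongr; linarith
        _ = ε / 2 := by simp only [η]; field_simp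
    have h2 : ∑ l ∈ S.filter (· ∉ T), 2 / |μ l| ≤ ε / 2 := by
      set S' := S.filter (· ∉ T)
      have hS' : ∀ l ∈ S', l ∈ Λ := fun l hl => hS (Finset.mem_filter.1 hl).1
      have h3 := hs (S'.subtype (· ∈ Λ)) (by
        rw [Finset.disjoint_left]
        intro l hl hls
        rw [Finset.mem_subtype] at hl
        exact (Finset.mem_filter.1 hl).2 (Finset.mem_map_of_mem _ hls))
      rw [Finset.sum_subtype_of_mem (fun l => 1 / |μ l|) hS'] at h3
      have h4 := (le_abs_self _).trans h3.le
      calc ∑ l ∈ S', 2 / |μ l| = 2 * ∑ l ∈ S', 1 / |μ l| := by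
            rw [Finset.mul_sum]
            exact Finset.sum_congr rfl fun l _ => by ring
        _ ≤ _ := by linarith
    linarith

/-- Integration against a continuous density, as a functional on `C([a, b])`. -/
noncomputable def integralDual (a b : ℝ) (g : ℝ → ℂ) (hg : Continuous g) :
    StrongDual ℂ C(Set.Icc a b, ℂ) :=
  let ν : Measure (Set.Icc a b) := Measure.comap (↑) (volume : Measure ℝ)
  have : IsFiniteMeasure ν := ⟨by
    rw [comap_subtype_coe_apply measurableSet_Icc, Set.image_univ, Subtype.range_coe]
    exact isCompact_Icc.measure_lt_top⟩
  have hint : ∀ f : C(Set.Icc a b, ℂ), Integrable (fun t : Set.Icc a b => g t * f t) ν := fun f =>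
    Continuous.integrable_of_hasCompactSupport (by fun_prop) (HasCompactSupport.of_compactSpace _)
  LinearMap.mkContinuousOfExistsBound
    ({ toFun := fun f => ∫ t : Set.Icc a b, g t * f t ∂ν
       map_add' := fun f₁ f₂ => by
         simp only [ContinuousMap.add_apply, mul_add]
         exact integral_add (hint f₁) (hint f₂)
       map_smul' := fun k f => by
         simp only [ContinuousMap.smul_apply, smul_eq_mul, RingHom.id_apply, mul_left_comm _ k]
         exact integral_const_mul _ _ } : C(Set.Icc a b, ℂ) →ₗ[ℂ] ℂ) (by
    obtain ⟨M, hM⟩ := isCompact_Icc.exists_bound_of_continuousOn hg.continuousOn (s := Set.Icc a b)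
    refine ⟨M * ν.real Set.univ, fun f => ?_⟩
    refine (norm_integral_le_of_norm_le_const (C := M * ‖f‖)
      (Filter.Eventually.of_forall fun t => ?_)).trans_eq (by ring)
    rw [norm_mul]
    exact mul_le_mul (hM t t.2) (f.norm_coe_le_norm t) (norm_nonneg _)
      ((norm_nonneg _).trans (hM t t.2)))

theorem integralDual_apply {a b : ℝ} {g : ℝ → ℂ} (hg : Continuous g) {f : C(Set.Icc a b, ℂ)}
    {u : ℝ → ℂ} (h : ∀ t : Set.Icc a b, f t = u t) :
    integralDual a b g hg f = ∫ t in Set.Icc a b, g t * u t := by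
  rw [← integral_subtype_comap measurableSet_Icc]
  change ∫ t : Set.Icc a b, g t * f t ∂(Measure.comap (↑) (volume : Measure ℝ)) = _
  simp only [h]

/-- If `z ↦ ℓ(φ(· - z))` has a zero of high order at `z₀`, then `ℓ` annihilates the translate by
`z₀` of every `P(D) φ` with `P` of low degree. -/
theorem dual_aeval_gaussianTranslate_eq_zero {a b c : ℝ} (ℓ : StrongDual ℂ C(Set.Icc a b, ℂ))
    {N : ℕ} {f G : ℂ → ℂ} (hf : Differentiable ℂ f) (hG : Differentiable ℂ G)
    (h : ∀ z, ℓ (gaussianTranslate a b c 1 z) = f z ^ N * G z) {z₀ : ℂ} (hz₀ : f z₀ = 0)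
    (P : ℂ[X]) (hP : P.natDegree < N) :
    ℓ (gaussianTranslate a b c (aeval (gaussianDeriv c) P 1) z₀) = 0 := by
  have key : ∀ k ≤ N, ∃ G : ℂ → ℂ, Differentiable ℂ G ∧
      ∀ z, ℓ (gaussianTranslate a b c ((gaussianDeriv c ^ k) 1) z) = f z ^ (N - k) * G z := by
    intro k
    induction k with
    | zero => exact fun _ => ⟨G, hG, by simpa using h⟩
    | succ k ih =>
      intro hk
      obtain ⟨G, hG, hGk⟩ := ih (by omega)
      obtain ⟨m, hm⟩ : ∃ m, N - k = m + 1 := ⟨N - k - 1, by omega⟩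
      have hm' : N - (k + 1) = m := by omega
      refine ⟨fun z => -((m + 1) * deriv f z * G z + f z * deriv G z),
        ((((hf.deriv.const_mul _).mul hG).add (hf.mul hG.deriv)).neg), fun z => ?_⟩
      have h1 := hasDerivAt_dual_gaussianTranslate (c := c) ℓ ((gaussianDeriv c ^ k) 1) z
      simp only [hGk, hm] at h1
      have h2 := (((hf z).hasDerivAt.fun_pow (m + 1)).fun_mul (hG z).hasDerivAt).unique h1
      rw [pow_succ' (gaussianDeriv c), Module.End.mul_apply, hm', ← neg_neg (ℓ _), ← h2]
      push_cast
      ring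
  let L : ℂ[X] →ₗ[ℂ] ℂ :=
    { toFun := fun r => ℓ (gaussianTranslate a b c r z₀)
      map_add' := fun r s => by rw [gaussianTranslate_add, map_add]
      map_smul' := fun k r => by rw [gaussianTranslate_smul, map_smul]; rfl }
  change L _ = 0
  rw [aeval_eq_sum_range, LinearMap.sum_apply, map_sum]
  refine Finset.sum_eq_zero fun k hk => ?_
  have hkN : k < N := by simp at hk; omega
  obtain ⟨G, -, hGk⟩ := key k hkN.le
  rw [LinearMap.smul_apply, map_smul]
  change _ • ℓ _ = 0
  rw [hGk, hz₀, zero_pow (by omega), zero_mul, smul_zero]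

theorem summable_one_div_abs_sub {Λ : Set ℝ}
    (h : ∑' l : {l : ℝ // l ∈ Λ ∧ l ≠ 0}, ENNReal.ofReal (1 / |(l : ℝ)|) ≠ ∞) (z : ℝ) :
    Summable fun l : Λ => 1 / |(l : ℝ) - z| := by
  let f : ℝ → ℝ≥0∞ := fun l => ENNReal.ofReal (1 / |l|)
  have h1 : ∑' l : Λ, f l ≠ ∞ := by
    have : ∑' l : {l : ℝ | l ∈ Λ ∧ l ≠ 0}, f l = ∑' l : Λ, f l := by
      rw [tsum_subtype {l : ℝ | l ∈ Λ ∧ l ≠ 0} f, tsum_subtype Λ f]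
      congr 1
      ext l
      by_cases hl : l = 0
      · subst hl
        simp [Set.indicator, f]
      · by_cases hlΛ : l ∈ Λ <;> simp [Set.indicator, hl, hlΛ]
    rw [← this]
    exact h
  have h2 : Summable fun l : Λ => 1 / |(l : ℝ)| := by
    refine (ENNReal.summable_toReal h1).congr fun l => ?_
    exact ENNReal.toReal_ofReal (by positivity)
  refine Summable.of_norm_bounded_eventually (h2.mul_left 2) ?_
  have h3 := h2.tendsto_cofinite_zero.eventually_lt_const
    (show (0 : ℝ) < 1 / (2 * |z| + 1) by positivity)
  have h4 : ∀ᶠ l : Λ in Filter.cofinite, (l : ℝ) ≠ 0 := by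
    refine Set.Subsingleton.finite fun l hl m hm => Subtype.ext ?_
    simp only [Set.mem_compl_iff, Set.mem_ofPred_eq, not_not] at hl hm
    rw [hl, hm]
  filter_upwards [h3, h4] with l hl hl0
  have hpos := abs_pos.2 hl0
  rw [one_div_lt_one_div hpos (by positivity)] at hl
  have h5 := abs_sub_abs_le_abs_sub (l : ℝ) z
  rw [Real.norm_eq_abs, abs_of_nonneg (by positivity), mul_one_div,
    div_le_div_iff₀ (by linarith) hpos]
  linarith

/-- If the reciprocals of `Λ` are summable, every finite subset of the translates is annihilated by
a density on `[a, b]` that is bounded independently of the subset and normalized against one fixed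
function `u`. -/
theorem exists_annihilating_densities (q : ℂ[X]) {a b c : ℝ} (hc : 0 < c) (hab : a < b) {Λ : Set ℝ}
    (hΛ : Λ.Countable)
    (hsum : ∑' l : {l : ℝ // l ∈ Λ ∧ l ≠ 0}, ENNReal.ofReal (1 / |(l : ℝ)|) ≠ ∞) :
    ∃ (u : ℝ → ℂ) (B : ℝ), Continuous u ∧ ∀ S : Finset ℝ, ↑S ⊆ Λ → ∃ g : ℝ → ℂ, Continuous g ∧
      (∀ t, ‖g t‖ ≤ B) ∧
      (∀ l ∈ S, ∫ t in Set.Icc a b, g t * polyGaussian q c (t - l) = 0) ∧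
      ∫ t in Set.Icc a b, g t * u t = 1 := by
  classical
  obtain ⟨P, hP⟩ := exists_aeval_gaussianDeriv_eq hc.ne' q
  set N := P.natDegree + 1
  -- The Laplace transforms below are normalized at the point `z₀`, which must avoid `Λ`.
  obtain ⟨z₀, hz₀⟩ : ∃ z₀, z₀ ∉ Λ := (hΛ.dense_compl ℝ).nonempty
  set μ : ℝ → ℝ := fun l => 2 * c * (l - z₀)
  have hμ : ∀ l ∈ Λ, μ l ≠ 0 := fun l hl => by
    refine mul_ne_zero (by positivity) (sub_ne_zero.2 ?_)
    rintro rfl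
    exact hz₀ hl
  have hμs : Summable fun l : Λ => 1 / |μ l| := by
    refine ((summable_one_div_abs_sub hsum z₀).mul_left (1 / (2 * c))).congr fun l => ?_
    simp only [μ]
    rw [abs_mul, abs_of_pos (by positivity : 0 < 2 * c), one_div_mul_one_div]
  obtain ⟨σ, T, hTΛ, hσ, hσT, hσS⟩ := exists_widths hμ hμs
    (show 0 < (b - a) / (4 * N) from div_pos (by linarith) (by positivity))
  set α : ℝ → ℝ := fun l => cothHalf (σ l * μ l)
  obtain ⟨h₀, B₀, hh₀, hl₀⟩ := exists_isFourierBounded ((a + b) / 2)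
    (show 0 < (b - a) / 4 by linarith)
  -- passing between `h` and the density `g = h * E`
  let E : ℝ → ℂ := fun t => Complex.exp (c * t ^ 2 - 2 * c * z₀ * t)
  have hE : Continuous E := by fun_prop
  obtain ⟨M, hM⟩ := isCompact_Icc.exists_bound_of_continuousOn hE.continuousOn (s := Set.Icc a b)
  have hM0 : 0 ≤ M := (norm_nonneg _).trans (hM a ⟨le_rfl, hab.le⟩)
  have hsupp : ∀ {h B}, IsFourierBounded h ((a + b) / 2) ((b - a) / 2) B →
      ∀ t, t ∉ Set.Icc a b → h t = 0 := by
    intro h B hh t ht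
    refine hh.eq_zero t ?_
    by_contra hle
    rw [not_lt, abs_le] at hle
    exact ht ⟨by linarith [hle.1], by linarith [hle.2]⟩
  have hlap : ∀ {h B}, (hh : IsFourierBounded h ((a + b) / 2) ((b - a) / 2) B) → ∀ z,
      integralDual a b (fun t => h t * E t) (hh.continuous.mul hE) (gaussianTranslate a b c 1 z) =
        Complex.exp (-c * z ^ 2) * laplace h (2 * c * (z - z₀)) := by
    intro h B hh z
    rw [integralDual_apply (u := fun t => Complex.exp (-c * ((t : ℂ) - z) ^ 2)) _ fun t => by
      rw [gaussianTranslate_apply, eval_one, one_mul]]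
    rw [setIntegral_eq_integral_of_forall_compl_eq_zero fun t ht => by
      rw [hsupp hh t ht, zero_mul, zero_mul], laplace, ← integral_const_mul]
    congr 1
    ext t
    rw [mul_assoc, ← Complex.exp_add, mul_left_comm, ← mul_assoc, mul_comm (h t),
      ← Complex.exp_add]
    ring_nf
  have hh₀' := hh₀.mono (ρ' := (b - a) / 2) (by linarith) le_rfl
  have hH₀ : Differentiable ℂ fun z =>
      Complex.exp (-c * z ^ 2) * laplace h₀ (2 * c * (z - z₀)) := fun z => by
    simp only [← hlap hh₀']
    exact (hasDerivAt_dual_gaussianTranslate _ 1 z).differentiableAt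
  refine ⟨fun t => Complex.exp (-(c * t ^ 2 - 2 * c * z₀ * t)),
    (∏ l ∈ T, threePointBound (α l) ^ N) * B₀ * M, by fun_prop, fun S hS => ?_⟩
  -- Only the factors of `T` exceed `1`, so adding `T` to `S` makes the bound independent of `S`.
  set S' := S ∪ T
  have hS' : ↑S' ⊆ Λ := by simp [S', hS, hTΛ]
  obtain ⟨h, hh, hhl⟩ := hh₀.exists_threePoint_prod S' (fun l hl => (hσ l (hS' hl)).le) α N
  have hprod : ∏ l ∈ S', threePointBound (α l) ^ N = ∏ l ∈ T, threePointBound (α l) ^ N := by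
    refine (Finset.prod_subset Finset.subset_union_right fun l hl hlT => ?_).symm
    rw [threePointBound_cothHalf (hσT l (hS' hl) hlT), one_pow]
  rw [hprod] at hh
  have hρ : (b - a) / 4 + N * ∑ l ∈ S', σ l ≤ (b - a) / 2 := by
    have h1 := mul_le_mul_of_nonneg_left (hσS S' hS') (Nat.cast_nonneg (α := ℝ) N)
    have h2 : (N : ℝ) * ((b - a) / (4 * N)) = (b - a) / 4 := by
      have : (N : ℝ) ≠ 0 := by simp [N]; positivity
      field_simp
    linarith
  have hh' := hh.mono hρ le_rfl
  refine ⟨fun t => h t * E t, hh.continuous.mul hE, fun t => ?_, fun l hl => ?_, ?_⟩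
  · by_cases ht : t ∈ Set.Icc a b
    · rw [norm_mul]
      exact mul_le_mul (hh.norm_le t) (hM t ht) (norm_nonneg _)
        ((norm_nonneg _).trans (hh.norm_le t))
    · simp only [hsupp hh' t ht, zero_mul, norm_zero]
      exact mul_nonneg ((norm_nonneg _).trans (hh.norm_le t)) hM0
  · have hlS' : l ∈ S' := Finset.mem_union_left _ hl
    have hlΛ := hS' hlS'
    have hsym : ∀ m, Differentiable ℂ
        fun z : ℂ => threePointSymbol (σ m) (α m) (2 * c * (z - z₀)) :=
      fun m => (differentiable_threePointSymbol _ _).comp (by fun_prop)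
    have hzero := dual_aeval_gaussianTranslate_eq_zero
      (integralDual a b (fun t => h t * E t) (hh.continuous.mul hE)) (N := N) (c := c)
      (f := fun z => threePointSymbol (σ l) (α l) (2 * c * (z - z₀)))
      (G := fun z => (∏ m ∈ S'.erase l, threePointSymbol (σ m) (α m) (2 * c * (z - z₀)) ^ N) *
        (Complex.exp (-c * z ^ 2) * laplace h₀ (2 * c * (z - z₀))))
      (hsym l) (Differentiable.mul (Differentiable.fun_finsetProd fun m _ => (hsym m).pow N) hH₀)
      (fun z => by
        rw [hlap hh', hhl, ← Finset.mul_prod_erase S' _ hlS']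
        ring)
      (z₀ := l) (by
        have : (2 * c * (l - z₀) : ℂ) = ((μ l : ℝ) : ℂ) := by simp [μ]
        rw [this]
        exact threePointSymbol_cothHalf (mul_ne_zero (hσ l hlΛ).ne' (hμ l hlΛ)))
      P (Nat.lt_succ_self _)
    rw [hP] at hzero
    rw [← hzero]
    exact (integralDual_apply _ fun t =>
      (polyGaussian_sub_eq_gaussianTranslate a b c q l t).symm).symm
  · have h1 : ∀ t : ℝ, h t * E t * Complex.exp (-(c * t ^ 2 - 2 * c * z₀ * t)) =
        Complex.exp (0 * t) * h t := fun t => by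
      rw [mul_assoc, ← Complex.exp_add, add_neg_cancel, zero_mul, mul_comm]
    simp only [h1]
    rw [setIntegral_eq_integral_of_forall_compl_eq_zero fun t ht => by
      rw [hsupp hh' t ht, mul_zero]]
    change laplace h 0 = 1
    rw [hhl, hl₀]
    simp [threePointSymbol_zero]

/-! ### Incompleteness in `L^p` -/

/-- A fixed function `u` stays at a positive distance from the span when the reciprocals of `Λ` are
summable: a density killing finitely many translates is bounded by `B` and has integral `1` against
`u`. -/
theorem tsum_inv_eq_top_of_completeInLp (q : ℂ[X]) {a b c : ℝ} (hc : 0 < c) (hab : a < b)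
    {Λ : Set ℝ} (hΛ : Λ.Countable) {p : ℝ≥0∞} [hp1 : Fact (1 ≤ p)]
    (h : CompleteInLp p a b (translates (polyGaussian q c) Λ)) :
    ∑' l : {l : ℝ // l ∈ Λ ∧ l ≠ 0}, ENNReal.ofReal (1 / |(l : ℝ)|) = ∞ := by
  classical
  by_contra hsum
  obtain ⟨u, B, hu, hB⟩ := exists_annihilating_densities q hc hab hΛ hsum
  set ν := volume.restrict (Set.Icc a b)
  let U : Lp ℂ p ν := iccToLp hab.le p ⟨fun t => u t, by fun_prop⟩
  have hU : U =ᵐ[ν] u := iccToLp_ae_eq hab.le p fun t => rfl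
  have hint : ∀ v : Lp ℂ p ν, Integrable v ν := fun v =>
    (Lp.memLp v).integrable hp1.out
  have hintg : ∀ (v : Lp ℂ p ν) {g : ℝ → ℂ}, Continuous g → (∀ t, ‖g t‖ ≤ B) →
      Integrable (fun t => g t * v t) ν := fun v g hg hgB =>
    (hint v).bdd_mul hg.aestronglyMeasurable (Filter.Eventually.of_forall hgB)
  -- An element of the span is killed by every density that kills finitely many translates.
  have hspan : ∀ v ∈ Submodule.span ℂ {g : Lp ℂ p ν |
      ∃ u ∈ translates (polyGaussian q c) Λ, g =ᵐ[ν] u}, ∃ S : Finset ℝ, ↑S ⊆ Λ ∧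
      ∀ g : ℝ → ℂ, Continuous g → (∀ t, ‖g t‖ ≤ B) →
        (∀ l ∈ S, ∫ t in Set.Icc a b, g t * polyGaussian q c (t - l) = 0) →
        ∫ t, g t * v t ∂ν = 0 := by
    intro v hv
    induction hv using Submodule.span_induction with
    | mem v hv =>
      obtain ⟨_, ⟨l, hl, rfl⟩, hvl⟩ := hv
      refine ⟨{l}, by simpa using hl, fun g _ _ hgl => ?_⟩
      rw [← hgl l (by simp)]
      refine integral_congr_ae ?_
      filter_upwards [hvl] with t ht
      rw [ht]
    | zero =>
      refine ⟨∅, by simp, fun g _ _ _ => ?_⟩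
      refine integral_eq_zero_of_ae ?_
      filter_upwards [Lp.coeFn_zero ℂ p ν] with t ht
      rw [ht, Pi.zero_apply, mul_zero]
    | add v w _ _ hv hw =>
      obtain ⟨S, hS, hSv⟩ := hv
      obtain ⟨T, hT, hTw⟩ := hw
      refine ⟨S ∪ T, by simp [hS, hT], fun g hg hgB hgl => ?_⟩
      have h1 := hSv g hg hgB fun l hl => hgl l (Finset.mem_union_left _ hl)
      have h2 := hTw g hg hgB fun l hl => hgl l (Finset.mem_union_right _ hl)
      rw [← add_zero (0 : ℂ)]
      nth_rw 1 [← h1]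
      rw [← h2, ← integral_add (hintg v hg hgB) (hintg w hg hgB)]
      refine integral_congr_ae ?_
      filter_upwards [Lp.coeFn_add v w] with t ht
      rw [ht, Pi.add_apply, mul_add]
    | smul k v _ hv =>
      obtain ⟨S, hS, hSv⟩ := hv
      refine ⟨S, hS, fun g hg hgB hgl => ?_⟩
      rw [← mul_zero k, ← hSv g hg hgB hgl, ← integral_const_mul]
      refine integral_congr_ae ?_
      filter_upwards [Lp.coeFn_smul k v] with t ht
      rw [ht, Pi.smul_apply, smul_eq_mul, mul_left_comm]
  -- On a bounded interval the `L^1` norm is controlled by the `L^p` norm.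
  set m : ℝ := (ν Set.univ ^ (1 / (1 : ℝ≥0∞).toReal - 1 / p.toReal)).toReal
  have hB0 : 0 ≤ B := by
    obtain ⟨g, -, hgB, -⟩ := hB ∅ (by simp)
    exact (norm_nonneg _).trans (hgB 0)
  have hL1 : ∀ v : Lp ℂ p ν, ∫ t, ‖v t‖ ∂ν ≤ ‖v‖ * m := by
    intro v
    rw [integral_norm_eq_lintegral_enorm (Lp.aestronglyMeasurable v),
      ← eLpNorm_one_eq_lintegral_enorm, Lp.norm_def, ← ENNReal.toReal_mul]
    refine ENNReal.toReal_mono (ENNReal.mul_ne_top (Lp.eLpNorm_ne_top v) ?_)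
      (eLpNorm_le_eLpNorm_mul_rpow_measure_univ hp1.out (Lp.aestronglyMeasurable v))
    refine ENNReal.rpow_ne_top_of_nonneg ?_ (measure_ne_top _ _)
    rw [ENNReal.toReal_one, sub_nonneg, one_div_one]
    rcases eq_or_ne p ∞ with rfl | hp
    · simp
    · have h1 : 1 ≤ p.toReal := by
        simpa using ENNReal.toReal_mono hp hp1.out
      rw [div_le_one (by linarith)]
      exact h1
  have hm0 : 0 ≤ m := ENNReal.toReal_nonneg
  obtain ⟨v, hv, hvU⟩ := Metric.mem_closure_iff.1 (h U) (1 / (B * m + 1)) (by positivity)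
  obtain ⟨S, hS, hSv⟩ := hspan v hv
  obtain ⟨g, hg, hgB, hgl, hgu⟩ := hB S hS
  have h1 : ∫ t, g t * (U - v) t ∂ν = 1 := by
    have h2 : ∫ t, g t * U t ∂ν = 1 := by
      rw [← hgu]
      refine integral_congr_ae ?_
      filter_upwards [hU] with t ht
      rw [ht]
    rw [← sub_zero (1 : ℂ), ← h2, ← hSv g hg hgB hgl,
      ← integral_sub (hintg U hg hgB) (hintg v hg hgB)]
    refine integral_congr_ae ?_
    filter_upwards [Lp.coeFn_sub U v] with t ht
    rw [ht, Pi.sub_apply, mul_sub]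
  have h2 : ‖∫ t, g t * (U - v) t ∂ν‖ ≤ B * (‖U - v‖ * m) := by
    refine (norm_integral_le_of_norm_le ((hint (U - v)).norm.const_mul B)
      (Filter.Eventually.of_forall fun t => ?_)).trans ?_
    · rw [norm_mul]
      exact mul_le_mul_of_nonneg_right (hgB t) (norm_nonneg _)
    · rw [integral_const_mul]
      exact mul_le_mul_of_nonneg_left (hL1 _) hB0
  rw [h1, norm_one] at h2
  rw [dist_eq_norm, lt_div_iff₀ (by positivity)] at hvU
  nlinarith [norm_nonneg (U - v)]

theorem theorem1 (q : ℂ[X]) (hq : q ≠ 0) (c : ℝ) (hc : 0 < c) (a b : ℝ) (hab : a < b)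
    (Λ : Set ℝ) (hΛ : Λ.Countable) :
    (CompleteInC a b (translates (polyGaussian q c) Λ) ↔
      ∑' l : {l : ℝ // l ∈ Λ ∧ l ≠ 0}, ENNReal.ofReal (1 / |(l : ℝ)|) = ∞) ∧
    ∀ (p : ℝ≥0∞) [Fact (1 ≤ p)], p ≠ ∞ →
      (CompleteInLp p a b (translates (polyGaussian q c) Λ) ↔
        ∑' l : {l : ℝ // l ∈ Λ ∧ l ≠ 0}, ENNReal.ofReal (1 / |(l : ℝ)|) = ∞) := by
  refine ⟨⟨fun h => ?_, completeInC_of_tsum_inv_eq_top hq hc⟩,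
    fun p _ hp => ⟨fun h => ?_, fun h => ?_⟩⟩
  · exact tsum_inv_eq_top_of_completeInLp q hc hab hΛ (h.completeInLp hab.le 1 ENNReal.one_ne_top)
  · exact tsum_inv_eq_top_of_completeInLp q hc hab hΛ h
  · exact (completeInC_of_tsum_inv_eq_top hq hc h).completeInLp hab.le p hp
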